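/- All graphs are finite and simple. A graph is \emph{outerplanar} if it has an embedding in the plane in which every vertex lies on the boundary of the unbounded face. A bipartite outerplanar graph is \emph{maximal} if joining any two distinct nonadjacent vertices by a new edge yields a graph that is not bipartite or not outerplanar. A graph is \emph{2-connected} if it has at least three vertices, is connected, and remains connected after the deletion of any one vertex. \textbf{Theorem.} Let $G$ be a 2-connected maximal bipartite outerplanar graph of order $n\ge 16$ with adjacency matrix $A$. For a vertex $v$ let $d(v)$ be its degree, and let $S_v(A^3)$ be the sum of the row of $A^3$ indexed by $v$, that is, the number of walks of length $3$ in $G$ starting at $v$. Then (1) for every vertex $v$ of $G$, $$S_v(A^3)\le\Bigl(d(v)+3+\frac{\frac{3n}{2}-6}{d(v)}\Bigr)\,d(v);$$ (2) the spectral radius $\rho(G)$, i.e. the maximum modulus of the eigenvalues of $A$, satisfies $$\rho(G)\le\sqrt{\frac{3n}{4}+2}.$$ -/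

import Mathlib

open scoped ENNReal

/-- `S` is a simple (Jordan) arc in the plane with endpoints `a` and `b`: the image of an injective
continuous map `γ : [0, 1] → ℂ` with `γ 0 = a` and `γ 1 = b`. The plane is modelled by `ℂ`. -/
def IsArcBetween (S : Set ℂ) (a b : ℂ) : Prop :=
  ∃ γ : Path a b, Function.Injective γ ∧ Set.range γ = S

/-- An embedding of a simple graph in the plane: distinct vertices are placed at distinct points,
every edge `uv` is drawn as a simple arc joining the points of `u` and `v`, an arc passes through no
vertex other than its two ends, and two distinct arcs meet at most in a common end. -/
structure PlaneEmbedding {V : Type*} (G : SimpleGraph V) where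
  /-- the point at which a vertex is placed -/
  pt : V → ℂ
  pt_injective : Function.Injective pt
  /-- the arc by which an edge is drawn (only the values at edges of `G` matter) -/
  arc : Sym2 V → Set ℂ
  isArc : ∀ u v : V, G.Adj u v → IsArcBetween (arc s(u, v)) (pt u) (pt v)
  mem_of_pt_mem_arc : ∀ (w : V) (e : Sym2 V), e ∈ G.edgeSet → pt w ∈ arc e → w ∈ e
  arc_inter_arc : ∀ e f : Sym2 V, e ∈ G.edgeSet → f ∈ G.edgeSet → e ≠ f →
    arc e ∩ arc f ⊆ pt '' {w | w ∈ e ∧ w ∈ f}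

namespace PlaneEmbedding

variable {V : Type*} {G : SimpleGraph V}

/-- The point set of the drawing: all vertices and all edges. -/
def support (E : PlaneEmbedding G) : Set ℂ :=
  Set.range E.pt ∪ ⋃ e ∈ G.edgeSet, E.arc e

/-- The faces are the connected components of the complement of the drawing. -/
def IsFace (E : PlaneEmbedding G) (F : Set ℂ) : Prop :=
  ∃ z ∈ E.supportᶜ, F = connectedComponentIn E.supportᶜ z

/-- An outer face is an unbounded face (a finite graph drawn in the plane has exactly one). -/
def IsOuterFace (E : PlaneEmbedding G) (F : Set ℂ) : Prop :=
  E.IsFace F ∧ ¬ Bornology.IsBounded F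

end PlaneEmbedding

/-- A graph is outerplanar if it can be embedded in the plane so that every vertex lies on the
boundary of the outer face. -/
def IsOuterplanar {V : Type*} (G : SimpleGraph V) : Prop :=
  ∃ (E : PlaneEmbedding G) (F : Set ℂ), E.IsOuterFace F ∧ ∀ v : V, E.pt v ∈ frontier F

/-- `G` is `k`-connected: it has more than `k` vertices, and it stays connected after the deletion
of any fewer than `k` vertices. -/
def IsKConnected {V : Type*} (k : ℕ) (G : SimpleGraph V) : Prop :=
  k < Nat.card V ∧ ∀ S : Finset V, S.card < k → (G.induce ((S : Set V)ᶜ)).Connected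

/-- `G` is a maximal bipartite outerplanar graph: it is bipartite and outerplanar, and joining any
two distinct nonadjacent vertices by a new edge destroys bipartiteness or outerplanarity. -/
def IsMaximalBipartiteOuterplanar {V : Type*} (G : SimpleGraph V) : Prop :=
  G.IsBipartite ∧ IsOuterplanar G ∧
    ∀ u v : V, u ≠ v → ¬ G.Adj u v →
      ¬ ((G ⊔ SimpleGraph.edge u v).IsBipartite ∧ IsOuterplanar (G ⊔ SimpleGraph.edge u v))

/-- The number of walks of length `k` in `G` that start at `v` (with any end vertex). -/
noncomputable def numWalksFrom {V : Type*} (G : SimpleGraph V) (k : ℕ) (v : V) : ℕ :=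
  Nat.card (Σ u : V, {p : G.Walk v u // p.length = k})

/-- The number of walks of length `k` starting at `v` is the row sum of the `k`-th power of the
adjacency matrix at `v`. -/
theorem numWalksFrom_eq_rowSum {V : Type*} [Fintype V] [DecidableEq V] (G : SimpleGraph V)
    [DecidableRel G.Adj] (k : ℕ) (v : V) :
    (numWalksFrom G k v : ℝ) = ∑ u : V, (G.adjMatrix ℝ ^ k) v u := by
  have h : numWalksFrom G k v = ∑ u : V, Fintype.card {p : G.Walk v u // p.length = k} := by
    unfold numWalksFrom
    rw [Nat.card_sigma]
    simp only [Nat.card_eq_fintype_card]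
  rw [h, Nat.cast_sum]
  refine Finset.sum_congr rfl fun u _ => ?_
  rw [SimpleGraph.adjMatrix_pow_apply_eq_card_walk]
  norm_cast

/-! The graph has a Hamiltonian cycle whose chords do not cross, and the walk count becomes a count
of chords. Both facts come from one obstruction: in an outerplanar graph two vertices cannot be
linked by three independent paths with inner vertices, since a point of the outer face, joined to
one inner vertex of each path, would complete a plane $K_{3,3}$
(`IsOuterplanar.exists_not_disjoint`). The nonplanarity of $K_{3,3}$ is proved with continuous
logarithms instead of the Jordan curve theorem (`exists_curves_meet`).

Put $v$ at position $0$ of the cycle and let $d=d(v)$. Then $S_v(A^3)$ is the sum of $d(w)$ over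
walks $v,u,w$. The walks with $w=v$ contribute $d^2$. The others are sorted by the gaps between
consecutive neighbours $l<r$ of $v$: noncrossing confines all edges involved to $[l,r]$, where
bipartiteness allows at most $(3(r-l)-1)/2$ edges, and a gap weighs at most $(3(r-l)+6)/2$
(`two_mul_gap_weight`). Summing over the $d-1$ gaps gives $S_v(A^3)\le d^2+3d+3n/2-6$, which is (1).

For (2), the degree vector is positive and $S_v(A^3)=(A^2d)_v$, so $\rho^2\le\max_v S_v(A^3)/d(v)$.
The bound $d+3+(3n/2-6)/d$ is convex in $d$ and $2\le d\le n/2$; for $n\ge 16$ its maximum is at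
$d=2$, with value $3n/4+2$. -/

/-! ### Continuous logarithms and the nonplanarity of $K_{3,3}$. -/

/-- A continuous nonvanishing function on a real topological vector space has a continuous
logarithm. -/
theorem exists_continuous_log {E : Type*} [NormedAddCommGroup E] [NormedSpace ℝ E] {g : E → ℂ}
    (hg : Continuous g) (h0 : ∀ x, g x ≠ 0) :
    ∃ h : E → ℂ, Continuous h ∧ ∀ x, Complex.exp (h x) = g x := by
  obtain ⟨F, ⟨-, hF⟩, -⟩ := Complex.isCoveringMapOn_exp.existsUnique_continuousMap_lifts
    ⟨g, hg⟩ (a₀ := 0) (e₀ := Complex.log (g 0)) (Complex.exp_log (h0 0)) h0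
  exact ⟨F, F.continuous, fun x => congrFun hF x⟩

/-- Two continuous logarithms of the same function on the line have the same increments. -/
theorem log_increment_unique {h k : ℝ → ℂ} (hh : Continuous h) (hk : Continuous k)
    (e : ∀ t, Complex.exp (h t) = Complex.exp (k t)) (s t : ℝ) : h s - h t = k s - k t := by
  have hE : ∀ x, Complex.exp (k x + (h t - k t)) = Complex.exp (k x) := fun x => by
    rw [Complex.exp_add, Complex.exp_sub, e t, div_self (Complex.exp_ne_zero _), mul_one]
  obtain ⟨F, -, hF⟩ := Complex.isCoveringMapOn_exp.existsUnique_continuousMap_lifts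
    (A := ℝ) ⟨fun x => Complex.exp (h x), by fun_prop⟩ (a₀ := t) (e₀ := h t) rfl
    (fun _ => Complex.exp_ne_zero _)
  have h1 := hF ⟨h, hh⟩ ⟨rfl, rfl⟩
  have h2 := hF ⟨fun x => k x + (h t - k t), by fun_prop⟩
    ⟨by simp, funext fun x => by simp [hE, e]⟩
  have h3 := DFunLike.congr_fun (h1.trans h2.symm) s
  simp only [ContinuousMap.coe_mk] at h3
  rw [h3]; ring

/-- The increment over `[0, 1]` of a continuous logarithm of `g` (zero if there is none). -/
noncomputable def logIncrement (g : ℝ → ℂ) : ℂ := by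
  classical
  exact if H : ∃ h : ℝ → ℂ, Continuous h ∧ ∀ x, Complex.exp (h x) = g x then
    H.choose 1 - H.choose 0 else 0

theorem logIncrement_eq {g h : ℝ → ℂ} (hh : Continuous h) (e : ∀ x, Complex.exp (h x) = g x) :
    logIncrement g = h 1 - h 0 := by
  have H : ∃ h : ℝ → ℂ, Continuous h ∧ ∀ x, Complex.exp (h x) = g x := ⟨h, hh, e⟩
  rw [logIncrement, dif_pos H]
  exact log_increment_unique H.choose_spec.1 hh (fun t => by rw [H.choose_spec.2, e]) 1 0

theorem exp_logIncrement {g : ℝ → ℂ} (hg : Continuous g) (h0 : ∀ x, g x ≠ 0) :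
    Complex.exp (logIncrement g) = g 1 / g 0 := by
  obtain ⟨h, hh, e⟩ := exists_continuous_log hg h0
  rw [logIncrement_eq hh e, Complex.exp_sub, e, e]

theorem logIncrement_neg {g : ℝ → ℂ} (hg : Continuous g) (h0 : ∀ x, g x ≠ 0) :
    logIncrement (fun x => -g x) = logIncrement g := by
  obtain ⟨h, hh, e⟩ := exists_continuous_log hg h0
  rw [logIncrement_eq hh e, logIncrement_eq (h := fun x => h x + Real.pi * Complex.I)
    (by fun_prop) (fun x => by rw [Complex.exp_add, e, Complex.exp_pi_mul_I]; ring)]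
  ring

/-- The total increment of the logarithm around a square vanishes. -/
theorem logIncrement_square {g : ℝ → ℝ → ℂ} (hg : Continuous fun p : ℝ × ℝ => g p.1 p.2)
    (h0 : ∀ s t, g s t ≠ 0) :
    logIncrement (fun s => g s 0) + logIncrement (fun t => g 1 t) =
      logIncrement (fun t => g 0 t) + logIncrement (fun s => g s 1) := by
  obtain ⟨h, hh, e⟩ := exists_continuous_log hg fun p => h0 p.1 p.2
  rw [logIncrement_eq (h := fun s => h (s, 0)) (by fun_prop) (fun s => e (s, 0)),
    logIncrement_eq (h := fun s => h (s, 1)) (by fun_prop) (fun s => e (s, 1)),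
    logIncrement_eq (h := fun t => h (0, t)) (by fun_prop) (fun t => e (0, t)),
    logIncrement_eq (h := fun t => h (1, t)) (by fun_prop) (fun t => e (1, t))]
  ring

/-- In a drawing of `K_{3,3}` by continuous curves, two disjoint edges meet. -/
theorem exists_curves_meet {x y : Fin 3 → ℂ} (γ : ∀ i j, Path (x i) (y j)) :
    ∃ i i' j j', i ≠ i' ∧ j ≠ j' ∧ ¬ Disjoint (Set.range (γ i j)) (Set.range (γ i' j')) := by
  by_contra! hdis
  set c : Fin 3 → Fin 3 → ℝ → ℂ := fun i j => (γ i j).extend with hc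
  have cc : ∀ i j, Continuous (c i j) := fun i j => (γ i j).continuous_extend
  have c0 : ∀ i j, c i j 0 = x i := fun i j => (γ i j).extend_zero
  have c1 : ∀ i j, c i j 1 = y j := fun i j => (γ i j).extend_one
  have hd : ∀ i i' j j', i ≠ i' → j ≠ j' → ∀ s t, c i j s - c i' j' t ≠ 0 := by
    intro i i' j j' hi hj s t h
    have h1 : c i j s ∈ Set.range (γ i j) := by rw [← Path.extend_range]; exact ⟨s, rfl⟩
    have h2 : c i' j' t ∈ Set.range (γ i' j') := by rw [← Path.extend_range]; exact ⟨t, rfl⟩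
    exact Set.disjoint_left.1 (hdis i i' j j' hi hj) h1 (sub_eq_zero.1 h ▸ h2)
  have hx : ∀ i j i', i ≠ i' → ∀ s, c i j s - x i' ≠ 0 := by
    intro i j i' hi s
    -- The point `x i'` is the start of the curve `c i' (j + 1)`, which is disjoint from `c i j`.
    rw [← c0 i' (j + 1)]
    exact hd i i' j (j + 1) hi (by simp) s 0
  have hy : ∀ i j j', j ≠ j' → ∀ s, c i j s - y j' ≠ 0 := by
    intro i j j' hj s
    rw [← c1 (i + 1) j']
    exact hd i (i + 1) j j' (by simp) hj s 1
  set b : Fin 3 → Fin 3 → Fin 3 → ℂ := fun i j i' => logIncrement fun s => c i j s - x i' with hb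
  set a : Fin 3 → Fin 3 → Fin 3 → ℂ := fun i j j' => logIncrement fun s => c i j s - y j' with ha
  -- For disjoint edges the difference of the two curves is nonzero on the whole parameter square,
  -- so its logarithm has no total increment around the boundary.
  have key : ∀ i i' j j', i ≠ i' → j ≠ j' →
      b i j i' + a i' j' j = b i' j' i + a i j j' := by
    intro i i' j j' hi hj
    have := logIncrement_square (g := fun s t => c i j s - c i' j' t)
      (((cc i j).comp continuous_fst).sub ((cc i' j').comp continuous_snd)) (hd i i' j j' hi hj)
    simp only [c0, c1] at this
    rw [← logIncrement_neg (g := fun t => y j - c i' j' t) (by fun_prop)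
        (fun t => by rw [← neg_ne_zero, neg_sub]; exact hy i' j' j hj.symm t),
      ← logIncrement_neg (g := fun t => x i - c i' j' t) (by fun_prop)
        (fun t => by rw [← neg_ne_zero, neg_sub]; exact hx i' j' i hi.symm t)] at this
    simpa only [neg_sub] using this
  -- Summing `key` over the 18 choices of `i` and `j ≠ j'` with `i' = i + 1` counts every `b`-term
  -- twice, and the `a`-terms cancel cyclically in `i`.
  have hQ : ∑ i, ∑ j, (b i j (i + 1) - b (i + 1) j i) = 0 := by
    simp only [Fin.sum_univ_three]
    have K := fun i j j' (h : j ≠ j') => key i (i + 1) j j' (by simp) h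
    have h1 := fun i => K i 0 1 (by decide)
    have h2 := fun i => K i 0 2 (by decide)
    have h3 := fun i => K i 1 0 (by decide)
    have h4 := fun i => K i 1 2 (by decide)
    have h5 := fun i => K i 2 0 (by decide)
    have h6 := fun i => K i 2 1 (by decide)
    have e0 : (0 : Fin 3) + 1 = 1 := rfl
    have e1 : (1 : Fin 3) + 1 = 2 := rfl
    have e2 : (2 : Fin 3) + 1 = 0 := rfl
    have A0 := h1 0; have A1 := h1 1; have A2 := h1 2
    have B0 := h2 0; have B1 := h2 1; have B2 := h2 2
    have C0 := h3 0; have C1 := h3 1; have C2 := h3 2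
    have D0 := h4 0; have D1 := h4 1; have D2 := h4 2
    have E0 := h5 0; have E1 := h5 1; have E2 := h5 2
    have F0 := h6 0; have F1 := h6 1; have F2 := h6 2
    rw [e0] at *; rw [e1] at *; rw [e2] at *
    linear_combination (1 / 2 : ℂ) * (A0 + A1 + A2 + B0 + B1 + B2 + C0 + C1 + C2 + D0 + D1 + D2 +
      E0 + E1 + E2 + F0 + F1 + F2)
  have hexp : ∀ i j i', i ≠ i' → Complex.exp (b i j i') = (y j - x i') / (x i - x i') := by
    intro i j i' hi
    rw [hb, exp_logIncrement (by fun_prop) (hx i j i' hi), c0, c1]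
  have hxx : ∀ i i', i ≠ i' → x i - x i' ≠ 0 := fun i i' h => by
    simpa only [c0] using hx i 0 i' h 0
  have hyx : ∀ i j, y j - x i ≠ 0 := fun i j => by
    simpa only [c1] using hx (i + 1) j i (by simp) 1
  have hterm : ∀ i j, Complex.exp (b i j (i + 1) - b (i + 1) j i) =
      -((y j - x (i + 1)) / (y j - x i)) := by
    intro i j
    rw [Complex.exp_sub, hexp _ _ _ (by simp), hexp _ _ _ (by simp), ← neg_sub (x i) (x (i + 1))]
    have := hxx i (i + 1) (by simp)
    have := hyx i j
    field_simp
  -- The fractions in `hterm` cancel cyclically in `i`, but the nine signs multiply to $-1$, while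
  -- $\exp 0=1$.
  have := congrArg Complex.exp hQ
  simp only [Complex.exp_sum, hterm, Complex.exp_zero, Fin.prod_univ_three] at this
  have e0 : (0 : Fin 3) + 1 = 1 := rfl
  have e1 : (1 : Fin 3) + 1 = 2 := rfl
  have e2 : (2 : Fin 3) + 1 = 0 := rfl
  rw [e0, e1, e2] at this
  have H := fun j => And.intro (hyx 0 j) (And.intro (hyx 1 j) (hyx 2 j))
  obtain ⟨p1, p2, p3⟩ := H 0
  obtain ⟨q1, q2, q3⟩ := H 1
  obtain ⟨r1, r2, r3⟩ := H 2
  field_simp at this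
  norm_num at this

/-- In a drawing of `K_{3,3}` by curves that run in given sets, the sets of two disjoint edges
meet. -/
theorem exists_joinedIn_meet {x y : Fin 3 → ℂ} {S : Fin 3 → Fin 3 → Set ℂ}
    (h : ∀ i j, JoinedIn (S i j) (x i) (y j)) :
    ∃ i i' j j', i < i' ∧ j ≠ j' ∧ ¬ Disjoint (S i j) (S i' j') := by
  obtain ⟨i, i', j, j', hi, hj, hd⟩ := exists_curves_meet fun i j => (h i j).somePath
  have hs : ∀ i j, Set.range (h i j).somePath ⊆ S i j := fun i j => by
    rintro _ ⟨t, rfl⟩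
    exact (h i j).somePath_mem t
  have hd' : ¬ Disjoint (S i j) (S i' j') := fun H => hd (H.mono (hs i j) (hs i' j'))
  rcases lt_or_gt_of_ne hi with hlt | hlt
  · exact ⟨i, i', j, j', hlt, hj, hd'⟩
  · exact ⟨i', i, j', j, hlt, hj.symm, fun H => hd' H.symm⟩

/-! ### Drawings of induced subgraphs and the obstruction to outerplanarity. -/

/-- There is a walk from `u` to `v` inside the vertex set `S`. -/
def SimpleGraph.LinkedIn {V : Type*} (G : SimpleGraph V) (S : Set V) (u v : V) : Prop :=
  ∃ p : G.Walk u v, ∀ x ∈ p.support, x ∈ S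

namespace SimpleGraph.LinkedIn

variable {V : Type*} {G : SimpleGraph V} {S : Set V} {u v w : V}

theorem refl (h : u ∈ S) : G.LinkedIn S u u := ⟨.nil, by simpa using h⟩

theorem trans (h : G.LinkedIn S u v) (h' : G.LinkedIn S v w) : G.LinkedIn S u w := by
  obtain ⟨p, hp⟩ := h
  obtain ⟨q, hq⟩ := h'
  refine ⟨p.append q, fun x hx => ?_⟩
  rcases (SimpleGraph.Walk.mem_support_append_iff _ _).1 hx with h | h
  exacts [hp x h, hq x h]

theorem symm (h : G.LinkedIn S u v) : G.LinkedIn S v u := by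
  obtain ⟨p, hp⟩ := h
  exact ⟨p.reverse, fun x hx => hp x (by simpa using hx)⟩

theorem of_adj (h : G.Adj u v) (hu : u ∈ S) (hv : v ∈ S) : G.LinkedIn S u v :=
  ⟨h.toWalk, by simp [hu, hv]⟩

theorem left_mem (h : G.LinkedIn S u v) : u ∈ S :=
  h.choose_spec _ (SimpleGraph.Walk.start_mem_support _)

theorem right_mem (h : G.LinkedIn S u v) : v ∈ S := h.symm.left_mem

end SimpleGraph.LinkedIn

namespace PlaneEmbedding

variable {V : Type*} {G : SimpleGraph V} (E : PlaneEmbedding G)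

/-- The drawing of the subgraph induced on `S`. -/
def drawing (S : Set V) : Set ℂ :=
  E.pt '' S ∪ ⋃ e ∈ {e ∈ G.edgeSet | ∀ w ∈ e, w ∈ S}, E.arc e

theorem drawing_univ : E.drawing Set.univ = E.support := by
  simp [drawing, support]

theorem drawing_mono {S T : Set V} (h : S ⊆ T) : E.drawing S ⊆ E.drawing T :=
  Set.union_subset_union (Set.image_mono h)
    (Set.biUnion_subset_biUnion_left fun _ he => ⟨he.1, fun w hw => h (he.2 w hw)⟩)

/-- This turns disjointness of vertex sets into disjointness in the plane: arcs meet only at common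
ends, and contain no other vertices. -/
theorem drawing_disjoint {S T : Set V} (h : Disjoint S T) :
    Disjoint (E.drawing S) (E.drawing T) := by
  rw [Set.disjoint_left] at h ⊢
  simp only [drawing, Set.mem_union, Set.mem_image, Set.mem_iUnion, Set.mem_ofPred, exists_prop]
  rintro z (⟨v, hv, rfl⟩ | ⟨e, ⟨he, heS⟩, hz⟩) (⟨w, hw, hwz⟩ | ⟨f, ⟨hf, hfT⟩, hz'⟩)
  · exact h hv (E.pt_injective hwz ▸ hw)
  · exact h hv (hfT v (E.mem_of_pt_mem_arc v f hf hz'))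
  · exact h (heS w (E.mem_of_pt_mem_arc w e he (hwz ▸ hz))) hw
  · have hne : e ≠ f := by
      rintro rfl
      induction e with
      | h u v => exact h (heS u (Sym2.mem_mk_left u v)) (hfT u (Sym2.mem_mk_left u v))
    obtain ⟨w, ⟨hwe, hwf⟩, -⟩ := E.arc_inter_arc e f he hf hne ⟨hz, hz'⟩
    exact h (heS w hwe) (hfT w hwf)

theorem isClosed_arc {e : Sym2 V} (he : e ∈ G.edgeSet) : IsClosed (E.arc e) := by
  induction e with
  | h u v =>
    obtain ⟨γ, -, h⟩ := E.isArc u v he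
    rw [← h]
    exact (isCompact_range γ.continuous).isClosed

theorem isClosed_drawing [Finite V] (S : Set V) : IsClosed (E.drawing S) :=
  (Set.toFinite _).isClosed.union
    ((Set.toFinite _).isClosed_biUnion fun _ he => E.isClosed_arc he.1)

theorem pt_mem_drawing_iff {S : Set V} {v : V} : E.pt v ∈ E.drawing S ↔ v ∈ S := by
  refine ⟨fun h => ?_, fun h => Or.inl ⟨v, h, rfl⟩⟩
  by_contra hv
  exact Set.disjoint_left.1 (E.drawing_disjoint (Set.disjoint_singleton_left.2 hv))
    (Or.inl ⟨v, rfl, rfl⟩) h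

theorem joinedIn_drawing {S : Set V} {u v : V} (h : G.LinkedIn S u v) :
    JoinedIn (E.drawing S) (E.pt u) (E.pt v) := by
  obtain ⟨p, hp⟩ := h
  induction p with
  | nil => exact JoinedIn.refl (E.pt_mem_drawing_iff.2 (hp _ (by simp)))
  | @cons u w v huw p ih =>
    refine JoinedIn.trans ?_ (ih fun x hx => hp x (by simp [hx]))
    obtain ⟨γ, -, hγ⟩ := E.isArc u w huw
    refine ⟨γ, fun t => Or.inr (Set.mem_biUnion (x := s(u, w)) ⟨huw, ?_⟩ (hγ ▸ ⟨t, rfl⟩))⟩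
    intro x hx
    rcases Sym2.mem_iff.1 hx with rfl | rfl
    · exact hp _ (by simp)
    · exact hp _ (by simp)

end PlaneEmbedding

/-- An outerplanar graph contains no three "independent" connections between two vertices, each
passing through a further vertex. -/
theorem IsOuterplanar.exists_not_disjoint {V : Type*} [Finite V] {G : SimpleGraph V}
    (hG : IsOuterplanar G) {a b : V} {p : Fin 3 → V} {A B : Fin 3 → Set V}
    (hA : ∀ i, G.LinkedIn (A i) a (p i)) (hB : ∀ i, G.LinkedIn (B i) b (p i)) :
    ∃ i j, i ≠ j ∧ ¬ Disjoint (A i) (B j) := by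
  by_contra! hdis
  obtain ⟨E, F, ⟨⟨z, hz, rfl⟩, -⟩, hfr⟩ := hG
  set F := connectedComponentIn E.supportᶜ z with hF
  have hop : IsOpen F := by
    rw [hF, ← E.drawing_univ]
    exact (E.isClosed_drawing _).isOpen_compl.connectedComponentIn
  have hconn : IsConnected F := isConnected_connectedComponentIn_iff.2 hz
  have hpath : IsPathConnected F := (hop.isConnected_iff_isPathConnected).1 hconn
  have hFD : ∀ S, Disjoint (E.drawing S) F := fun S => by
    refine Disjoint.mono_left (E.drawing_mono (Set.subset_univ S)) ?_
    rw [E.drawing_univ, Set.disjoint_right]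
    exact fun x hx => connectedComponentIn_subset _ _ hx
  have hball : ∀ i, ∃ ε > 0, Disjoint (E.drawing {p i}ᶜ) (Metric.ball (E.pt (p i)) ε) := by
    intro i
    obtain ⟨ε, hε, h⟩ := Metric.isOpen_iff.1 (E.isClosed_drawing {p i}ᶜ).isOpen_compl (E.pt (p i))
      (fun h => E.pt_mem_drawing_iff.1 h rfl)
    exact ⟨ε, hε, Set.disjoint_right.2 fun x hx => h hx⟩
  choose ε hε hball using hball
  -- As `p i` need not be accessible by a path inside `F`, the curve leaves `F` within a ball that
  -- meets only the parts of the drawing containing `p i`.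
  have hjoin : ∀ i, JoinedIn (F ∪ Metric.ball (E.pt (p i)) (ε i)) z (E.pt (p i)) := by
    intro i
    obtain ⟨x, hxF, hx⟩ := Metric.mem_closure_iff.1 (frontier_subset_closure (hfr (p i))) (ε i) (hε i)
    have h1 : JoinedIn F z x := hpath.joinedIn _ (mem_connectedComponentIn hz) _ hxF
    have h2 : JoinedIn (Metric.ball (E.pt (p i)) (ε i)) x (E.pt (p i)) :=
      ((convex_ball _ _).isPathConnected ⟨_, Metric.mem_ball_self (hε i)⟩).joinedIn _
        (by rwa [Metric.mem_ball, dist_comm]) _ (Metric.mem_ball_self (hε i))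
    exact (h1.mono Set.subset_union_left).trans (h2.mono Set.subset_union_right)
  have hsep : ∀ (S : Set V) i, p i ∉ S →
      Disjoint (E.drawing S) (F ∪ Metric.ball (E.pt (p i)) (ε i)) := fun S i h =>
    Set.disjoint_union_right.2 ⟨hFD S,
      (hball i).mono_left (E.drawing_mono fun x hx (hxp : x = p i) => h (hxp ▸ hx))⟩
  obtain ⟨i, i', j, j', hi, hj, hd⟩ := exists_joinedIn_meet (x := ![E.pt a, E.pt b, z])
    (y := fun j => E.pt (p j))
    (S := ![fun j => E.drawing (A j), fun j => E.drawing (B j),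
      fun j => F ∪ Metric.ball (E.pt (p j)) (ε j)]) (by
      intro i j
      fin_cases i
      · exact E.joinedIn_drawing (hA j)
      · exact E.joinedIn_drawing (hB j)
      · exact hjoin j)
  have hAp : p j' ∉ A j := fun h => Set.disjoint_left.1 (hdis j j' hj) h (hB j').right_mem
  have hBp : p j' ∉ B j := fun h => Set.disjoint_right.1 (hdis j' j hj.symm) h (hA j').right_mem
  apply hd
  fin_cases i <;> fin_cases i' <;> first | exact absurd hi (by decide) | skip
  · exact E.drawing_disjoint (hdis j j' hj)
  · exact hsep _ _ hAp
  · exact hsep _ _ hBp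

/-! ### Cycles with integer labels, Hamiltonicity and noncrossing chords. -/

theorem IsKConnected.linkedIn {V : Type*} {G : SimpleGraph V} (h : IsKConnected 2 G) {c u v : V}
    (hu : u ≠ c) (hv : v ≠ c) : G.LinkedIn {c}ᶜ u v := by
  obtain ⟨p⟩ := (h.2 {c} (by simp)).preconnected ⟨u, by simpa using hu⟩ ⟨v, by simpa using hv⟩
  refine ⟨p.map (SimpleGraph.Embedding.induce _).toHom, fun x hx => ?_⟩
  obtain ⟨y, -, rfl⟩ := List.mem_map.1 ((SimpleGraph.Walk.support_map _ p) ▸ hx)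
  simpa using y.2

/-- A walk into `C` from outside can be cut to a path that stays outside of `C` and ends at a
neighbour of `C`. -/
theorem SimpleGraph.LinkedIn.exists_isPath {V : Type*} {G : SimpleGraph V} {S C : Set V} {u v : V}
    (h : G.LinkedIn S u v) (hu : u ∉ C) (hv : v ∈ C) :
    ∃ z y, ∃ q : G.Walk u z, q.IsPath ∧ (∀ x ∈ q.support, x ∈ S ∧ x ∉ C) ∧ G.Adj z y ∧ y ∈ C ∧
      y ∈ S := by
  classical
  obtain ⟨p, hp⟩ := h
  suffices H : ∃ z y, ∃ q : G.Walk u z, (∀ x ∈ q.support, x ∈ S ∧ x ∉ C) ∧ G.Adj z y ∧ y ∈ C ∧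
      y ∈ S by
    obtain ⟨z, y, q, hq, h1, h2, h3⟩ := H
    exact ⟨z, y, q.bypass, q.bypass_isPath, fun x hx => hq x (q.support_bypass_subset_support hx), h1, h2, h3⟩
  induction p with
  | nil => exact absurd hv hu
  | @cons u w v huw p ih =>
    have hu' : u ∈ S := hp u (by simp)
    have hw' : w ∈ S := hp w (by simp)
    by_cases hw : w ∈ C
    · exact ⟨u, w, .nil, by simp [hu, hu'], huw, hw, hw'⟩
    · obtain ⟨z, y, q, hq, h⟩ := ih hw hv (fun x hx => hp x (by simp [hx]))
      refine ⟨z, y, .cons huw q, fun x hx => ?_, h⟩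
      rcases List.mem_cons.1 (by simpa using hx) with rfl | hx
      · exact ⟨hu', hu⟩
      · exact hq x hx

/-- A labelling of a cycle of length `m` by the integers modulo `m`; for `m = 2` the cycle
degenerates to an edge. -/
structure SimpleGraph.IsCyclicLabelling {V : Type*} (G : SimpleGraph V) (m : ℕ) (f : ℤ → V) :
    Prop where
  two_le : 2 ≤ m
  period : ∀ i, f (i + m) = f i
  adj : ∀ i, G.Adj (f i) (f (i + 1))
  dvd_sub : ∀ i j, f i = f j → (m : ℤ) ∣ i - j

namespace SimpleGraph.IsCyclicLabelling

variable {V : Type*} {G : SimpleGraph V} {m : ℕ} {f : ℤ → V}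

theorem ne (hf : G.IsCyclicLabelling m f) {i j : ℤ} (h : i < j) (h' : j < i + m) : f i ≠ f j := by
  intro e
  have := Int.le_of_dvd (by omega) (hf.dvd_sub j i e.symm)
  omega

theorem rotate (hf : G.IsCyclicLabelling m f) (c : ℤ) :
    G.IsCyclicLabelling m fun i => f (i + c) where
  two_le := hf.two_le
  period i := by rw [add_right_comm, hf.period]
  adj i := by rw [add_right_comm]; exact hf.adj _
  dvd_sub i j h := by simpa using hf.dvd_sub _ _ h

theorem reflect (hf : G.IsCyclicLabelling m f) : G.IsCyclicLabelling m fun i => f (-i) where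
  two_le := hf.two_le
  period i := by rw [← hf.period (-(i + m))]; congr 1; ring
  adj i := by
    have := (hf.adj (-(i + 1))).symm
    rwa [neg_add, neg_add_cancel_right, ← neg_add] at this
  dvd_sub i j h := by
    have := hf.dvd_sub _ _ h
    rwa [← dvd_neg, neg_sub_neg, neg_sub] at this

theorem of_linear {g : ℕ → V} (hm : 2 ≤ m) (hadj : ∀ i, i + 1 < m → G.Adj (g i) (g (i + 1)))
    (hlast : G.Adj (g (m - 1)) (g 0)) (hinj : ∀ i < m, ∀ j < m, g i = g j → i = j) :
    G.IsCyclicLabelling m fun i => g (i % m).toNat where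
  two_le := hm
  period i := by simp
  adj i := by
    have h0 := Int.emod_nonneg i (b := (m : ℤ)) (by omega)
    have h1 := Int.emod_lt_of_pos i (b := (m : ℤ)) (by omega)
    by_cases h : i % m = m - 1
    · have e : (i + 1) % (m : ℤ) = 0 := by
        rw [Int.add_emod, h, Int.emod_eq_of_lt (a := 1) (by omega) (by omega)]
        simp
      rw [h, e]
      convert hlast using 2
      · omega
      · rfl
    · have e : (i + 1) % (m : ℤ) = i % m + 1 := by
        rw [Int.add_emod, Int.emod_eq_of_lt (a := 1) (by omega) (by omega),
          Int.emod_eq_of_lt (by omega) (by omega)]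
      rw [e]
      convert hadj (i % m).toNat (by omega) using 2
      omega
  dvd_sub i j h := by
    have h0 := Int.emod_nonneg i (b := (m : ℤ)) (by omega)
    have h1 := Int.emod_lt_of_pos i (b := (m : ℤ)) (by omega)
    have h0' := Int.emod_nonneg j (b := (m : ℤ)) (by omega)
    have h1' := Int.emod_lt_of_pos j (b := (m : ℤ)) (by omega)
    have := hinj _ (by omega) _ (by omega) h
    exact Int.ModEq.dvd (n := m) (a := j) (b := i) (show j % m = i % m by omega)

theorem exists_eq (hf : G.IsCyclicLabelling m f) (c i : ℤ) :
    ∃ j, c ≤ j ∧ j < c + m ∧ f j = f i := by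
  have hm := hf.two_le
  have key : ∀ (k : ℕ) (i : ℤ), f (i + k * m) = f i := by
    intro k
    induction k with
    | zero => simp
    | succ k ih =>
      intro i
      rw [← ih i, ← hf.period (i + k * m)]
      congr 1; push_cast; ring
  have key' : ∀ (k i : ℤ), f (i + k * m) = f i := by
    intro k i
    obtain ⟨n, rfl | rfl⟩ := k.eq_nat_or_neg
    · exact key n i
    · rw [← key n]; congr 1; ring
  refine ⟨c + (i - c) % m, ?_, ?_, ?_⟩
  · have := Int.emod_nonneg (i - c) (b := (m : ℤ)) (by omega); omega
  · have := Int.emod_lt_of_pos (i - c) (b := (m : ℤ)) (by omega); omega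
  · rw [← key' ((i - c) / m)]
    congr 1
    have := Int.emod_add_mul_ediv (i - c) m
    linarith

theorem le_card [Fintype V] (hf : G.IsCyclicLabelling m f) : m ≤ Fintype.card V := by
  have : Function.Injective fun i : Fin m => f i := by
    intro i j h
    by_contra hne
    rcases lt_or_gt_of_ne (fun e => hne (Fin.ext e) : (i : ℕ) ≠ j) with hlt | hlt
    · exact hf.ne (i := i) (j := j) (by omega) (by omega) h
    · exact hf.ne (i := j) (j := i) (by omega) (by omega) h.symm
  simpa using Fintype.card_le_of_injective _ this

theorem linkedIn_image (hf : G.IsCyclicLabelling m f) {i j : ℤ} (hij : i ≤ j) :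
    G.LinkedIn (f '' Set.Icc i j) (f i) (f j) := by
  induction j, hij using Int.leInduction with
  | base => exact .refl ⟨i, ⟨le_rfl, le_rfl⟩, rfl⟩
  | succ j hj ih =>
    obtain ⟨p, hp⟩ := ih
    refine SimpleGraph.LinkedIn.trans ⟨p, fun x hx => ?_⟩ (.of_adj (hf.adj j)
      ⟨j, ⟨hj, by omega⟩, rfl⟩ ⟨j + 1, ⟨by omega, le_rfl⟩, rfl⟩)
    exact Set.image_mono (Set.Icc_subset_Icc_right (by omega)) (hp x hx)

/-- A path outside of the cycle that connects two consecutive vertices extends the cycle. -/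
theorem exists_extend (hf : G.IsCyclicLabelling m f) {x z : V} {q : G.Walk x z} (hq : q.IsPath)
    (hout : ∀ w ∈ q.support, w ∉ Set.range f) (hx : G.Adj x (f 0)) (hz : G.Adj z (f (-1))) :
    ∃ m' > m, ∃ f', G.IsCyclicLabelling m' f' := by
  have hm := hf.two_le
  -- The new cycle runs through `f 0, ..., f (m - 1)` and then along the path from `z` back to `x`.
  set g : ℕ → V := fun i => if i < m then f i else q.reverse.getVert (i - m) with hg
  have hmem : ∀ t, q.reverse.getVert t ∉ Set.range f := fun t =>
    hout _ (by simpa using q.reverse.getVert_mem_support t)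
  refine ⟨m + q.length + 1, by omega, _, of_linear (g := g) (by omega) ?_ ?_ ?_⟩
  · intro i hi
    rcases lt_trichotomy (i + 1) m with h | h | h
    · simp only [hg, if_pos h, if_pos (show i < m by omega)]
      exact_mod_cast hf.adj i
    · simp only [hg, if_pos (show i < m by omega), h, lt_irrefl, if_false, Nat.sub_self,
        SimpleGraph.Walk.getVert_zero]
      rw [← hf.period, show (-1 : ℤ) + m = i by omega] at hz
      exact hz.symm
    · simp only [hg, if_neg (show ¬ i + 1 < m by omega), if_neg (show ¬ i < m by omega)]
      rw [show i + 1 - m = i - m + 1 by omega]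
      exact q.reverse.adj_getVert_succ (by simp; omega)
  · simp only [hg, if_neg (show ¬ m + q.length + 1 - 1 < m by omega), if_pos (show 0 < m by omega)]
    rw [show m + q.length + 1 - 1 - m = q.reverse.length by simp,
      SimpleGraph.Walk.getVert_length]
    exact hx
  · intro i hi j hj h
    simp only [hg] at h
    split_ifs at h with h1 h2 h2
    · by_contra hne
      rcases lt_or_gt_of_ne hne with hlt | hlt
      · exact hf.ne (i := i) (j := j) (by omega) (by omega) h
      · exact hf.ne (i := j) (j := i) (by omega) (by omega) h.symm
    · exact absurd ⟨_, h⟩ (hmem _)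
    · exact absurd ⟨_, h.symm⟩ (hmem _)
    · have := hq.reverse.getVert_injOn (by simp; omega : i - m ≤ q.reverse.length)
        (by simp; omega : j - m ≤ q.reverse.length) h
      omega

end SimpleGraph.IsCyclicLabelling

namespace SimpleGraph.IsCyclicLabelling

variable {V : Type*} {G : SimpleGraph V} {m : ℕ} {f : ℤ → V}

/-- A path outside the cycle leaves it at `f 0` and returns at some `f j`. If these are consecutive,
the path is spliced in; otherwise it and the two arcs of the cycle are three independent
connections, which outerplanarity forbids. -/
theorem exists_longer [Finite V] (hf : G.IsCyclicLabelling m f) (hG : IsOuterplanar G)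
    (hconn : IsKConnected 2 G) (hmiss : ∃ x, x ∉ Set.range f) :
    ∃ m' > m, ∃ f', G.IsCyclicLabelling m' f' := by
  have hm := hf.two_le
  obtain ⟨x, c, hx, hxc⟩ : ∃ x c, x ∉ Set.range f ∧ G.Adj x (f c) := by
    obtain ⟨x, hx⟩ := hmiss
    have := hconn.linkedIn (c := f 0) (u := x) (v := f 1) (fun h => hx ⟨0, h.symm⟩)
      (hf.ne (i := 0) (j := 1) (by omega) (by omega)).symm
    obtain ⟨z, y, q, -, hq, hzy, ⟨c, rfl⟩, -⟩ := this.exists_isPath hx ⟨1, rfl⟩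
    exact ⟨z, c, (hq z q.end_mem_support).2, hzy⟩
  clear hmiss
  wlog hc : c = 0 generalizing f c
  · exact this (hf.rotate c) 0 (fun ⟨i, h⟩ => hx ⟨i + c, h⟩) (by simpa using hxc) rfl
  subst hc
  have h10 : f 1 ≠ f 0 := (hf.ne (i := 0) (j := 1) (by omega) (by omega)).symm
  obtain ⟨z, y, q, hqp, hq, hzy, ⟨j, rfl⟩, hj0⟩ :=
    (hconn.linkedIn (c := f 0) (u := x) (v := f 1) (fun h => hx ⟨0, h.symm⟩) h10).exists_isPath hx
      ⟨1, rfl⟩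
  have hqS : ∀ w ∈ q.support, w ∉ Set.range f := fun w hw => (hq w hw).2
  obtain ⟨j, hj, hj', e⟩ := hf.exists_eq 0 j
  rw [← e] at hzy hj0
  have hjne : j ≠ 0 := by rintro rfl; exact hj0 rfl
  have hp1 : f (-1) = f (m - 1) := by rw [← hf.period]; congr 1
  by_cases h1 : j = 1
  · subst h1
    exact hf.reflect.exists_extend hqp (fun w hw ⟨i, hi⟩ => hqS w hw ⟨-i, hi⟩) (by simpa using hxc)
      (by simpa using hzy)
  by_cases h2 : j = m - 1
  · subst h2
    exact hf.exists_extend hqp hqS hxc (hp1 ▸ hzy)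
  exfalso
  have hlt : ∀ s t : ℤ, 0 ≤ s → s < t → t < m → f s ≠ f t := fun s t h h' h'' =>
    hf.ne h' (by omega)
  obtain ⟨i, i', hii, hd⟩ := hG.exists_not_disjoint (a := f 0) (b := f j)
    (p := ![f 1, f (m - 1), x]) (A := ![f '' {0, 1}, f '' {0, (m : ℤ) - 1}, {f 0, x}])
    (B := ![f '' Set.Icc 1 j, f '' Set.Icc j (m - 1), {w | w = f j ∨ w ∈ q.support}])
    (by
      intro i
      fin_cases i
      · exact .of_adj (by simpa using hf.adj 0) ⟨0, by simp⟩ ⟨1, by simp⟩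
      · refine .of_adj ?_ ⟨0, by simp⟩ ⟨m - 1, by simp⟩
        simpa [hp1] using (hf.adj (-1)).symm
      · exact .of_adj hxc.symm (by simp) (by simp))
    (by
      intro i
      fin_cases i
      · exact (hf.linkedIn_image (by omega)).symm
      · exact hf.linkedIn_image (by omega)
      · refine SimpleGraph.LinkedIn.trans (.of_adj hzy.symm (Or.inl rfl) (Or.inr q.end_mem_support)) ?_
        exact SimpleGraph.LinkedIn.symm ⟨q, fun w hw => Or.inr hw⟩)
  have hI : ∀ S T : Set ℤ, S ⊆ Set.Ico 0 m → T ⊆ Set.Ico 0 m → Disjoint S T →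
      Disjoint (f '' S) (f '' T) := by
    intro S T hS hT hST
    rw [Set.disjoint_left]
    rintro _ ⟨s, hs, rfl⟩ ⟨t, ht, e⟩
    rcases lt_trichotomy s t with h | rfl | h
    · exact hlt s t (hS hs).1 h (hT ht).2 e.symm
    · exact Set.disjoint_left.1 hST hs ht
    · exact hlt t s (hT ht).1 h (hS hs).2 e
  have hR : ∀ T : Set ℤ, T ⊆ Set.Ico 1 m → Disjoint ({f 0, x} : Set V) (f '' T) := by
    intro T hT
    rw [Set.disjoint_left]
    rintro _ (rfl | rfl) ⟨t, ht, e⟩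
    · exact hlt 0 t le_rfl (by have := (hT ht).1; omega) (hT ht).2 e.symm
    · exact hx ⟨t, e⟩
  have hL : ∀ s : ℤ, 0 ≤ s → s < m → s ≠ j → Disjoint (f '' {0, s}) {w | w = f j ∨ w ∈ q.support} := by
    intro s h0 h1 h2
    rw [Set.disjoint_left]
    rintro _ ⟨t, ht, rfl⟩ (e | h)
    · have ht' : 0 ≤ t ∧ t < m ∧ t ≠ j := by rcases ht with rfl | rfl <;> omega
      rcases lt_or_gt_of_ne ht'.2.2 with h | h
      · exact hlt t j ht'.1 h (by omega) e
      · exact hlt j t hj h (by omega) e.symm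
    · exact hqS _ h ⟨t, rfl⟩
  apply hd
  fin_cases i <;> fin_cases i' <;> first | exact absurd rfl hii | skip
  · refine hI _ _ ?_ ?_ ?_
    · rintro t (rfl | rfl) <;> constructor <;> omega
    · rintro t ⟨_, _⟩; constructor <;> omega
    · rw [Set.disjoint_left]; rintro t (rfl | rfl) ⟨_, _⟩ <;> omega
  · exact hL 1 (by omega) (by omega) (Ne.symm h1)
  · refine hI _ _ ?_ ?_ ?_
    · rintro t (rfl | rfl) <;> constructor <;> omega
    · rintro t ⟨_, _⟩; constructor <;> omega
    · rw [Set.disjoint_left]; rintro t (rfl | rfl) ⟨_, _⟩ <;> omega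
  · exact hL (m - 1) (by omega) (by omega) (Ne.symm h2)
  · exact hR _ fun t ⟨_, _⟩ => ⟨by omega, by omega⟩
  · exact hR _ fun t ⟨_, _⟩ => ⟨by omega, by omega⟩

theorem odd_sub (hf : G.IsCyclicLabelling m f) (hG : G.IsBipartite) {i j : ℤ}
    (h : G.Adj (f i) (f j)) : Odd (j - i) := by
  obtain ⟨c⟩ := hG
  have h2 : ∀ i, c (f (i + 2)) = c (f i) := by
    intro i
    have h1 := c.valid (hf.adj i)
    have h2 := c.valid (hf.adj (i + 1))
    rw [add_assoc] at h2
    norm_num at h2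
    omega
  have key : ∀ (k : ℕ) (i : ℤ), c (f (i + 2 * k)) = c (f i) := by
    intro k
    induction k with
    | zero => simp
    | succ k ih =>
      intro i
      rw [← ih i, ← h2 (i + 2 * k)]
      congr 2
      push_cast; ring
  rw [← Int.not_even_iff_odd]
  rintro ⟨k, hk⟩
  apply c.valid h
  obtain ⟨n, rfl | rfl⟩ := k.eq_nat_or_neg
  · rw [show j = i + 2 * n by omega, key]
  · rw [show i = j + 2 * n by omega, key]

/-- A cycle with two crossing chords is a subdivided $K_4$. As $K_4$ itself is not bipartite, some
cycle edge is properly subdivided, which yields three independent connections between `f i` and `f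
j`. -/
theorem not_crossing [Finite V] (hf : G.IsCyclicLabelling m f) (hO : IsOuterplanar G)
    (hB : G.IsBipartite) {i j k l : ℤ} (hij : i < j) (hjk : j < k) (hkl : k < l) (hl : l < i + m)
    (hik : G.Adj (f i) (f k)) (hjl : G.Adj (f j) (f l)) : False := by
  have hm := hf.two_le
  wlog h2 : i + 2 ≤ j generalizing i j k l
  -- Here `j = i + 1`; since `k - i` is odd, `k ≥ j + 2`, so the four positions can be rotated by
  -- one.
  · obtain ⟨s, hs⟩ := hf.odd_sub hB hik
    refine this hjk hkl hl (by omega) hjl ?_ (by omega)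
    rw [hf.period]
    exact hik.symm
  obtain ⟨s, s', hss, hd⟩ := hO.exists_not_disjoint (a := f i) (b := f j)
    (p := ![f (i + 1), f k, f l]) (A := ![f '' {i, i + 1}, f '' {i, k}, f '' Set.Icc l (i + m)])
    (B := ![f '' Set.Icc (i + 1) j, f '' Set.Icc j k, f '' {j, l}])
    (by
      intro s
      fin_cases s
      · exact .of_adj (hf.adj i) ⟨i, by simp⟩ ⟨i + 1, by simp⟩
      · exact .of_adj hik ⟨i, by simp⟩ ⟨k, by simp⟩
      · rw [← hf.period i]
        exact (hf.linkedIn_image (by omega)).symm)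
    (by
      intro s
      fin_cases s
      · exact (hf.linkedIn_image (by omega)).symm
      · exact hf.linkedIn_image (by omega)
      · exact .of_adj hjl ⟨j, by simp⟩ ⟨l, by simp⟩)
  have hI : ∀ (c : ℤ) (S T : Set ℤ), S ⊆ Set.Ico c (c + m) → T ⊆ Set.Ico c (c + m) → Disjoint S T →
      Disjoint (f '' S) (f '' T) := by
    intro c S T hS hT hST
    rw [Set.disjoint_left]
    rintro _ ⟨s, hs, rfl⟩ ⟨t, ht, e⟩
    obtain ⟨_, _⟩ := hS hs
    obtain ⟨_, _⟩ := hT ht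
    rcases lt_trichotomy s t with h | rfl | h
    · exact hf.ne h (by omega) e.symm
    · exact Set.disjoint_left.1 hST hs ht
    · exact hf.ne h (by omega) e
  apply hd
  fin_cases s <;> fin_cases s' <;> first | exact absurd rfl hss | skip
  · refine hI i _ _ ?_ ?_ ?_
    · rintro t (rfl | rfl) <;> constructor <;> omega
    · rintro t ⟨_, _⟩; constructor <;> omega
    · rw [Set.disjoint_left]; rintro t (rfl | rfl) ⟨_, _⟩ <;> omega
  · refine hI i _ _ ?_ ?_ ?_
    · rintro t (rfl | rfl) <;> constructor <;> omega
    · rintro t (rfl | rfl) <;> constructor <;> omega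
    · rw [Set.disjoint_left]; rintro t (rfl | rfl) (h | h) <;> (try simp only [Set.mem_singleton_iff] at h) <;> omega
  · refine hI i _ _ ?_ ?_ ?_
    · rintro t (rfl | rfl) <;> constructor <;> omega
    · rintro t ⟨_, _⟩; constructor <;> omega
    · rw [Set.disjoint_left]; rintro t (rfl | rfl) ⟨_, _⟩ <;> omega
  · refine hI i _ _ ?_ ?_ ?_
    · rintro t (rfl | rfl) <;> constructor <;> omega
    · rintro t (rfl | rfl) <;> constructor <;> omega
    · rw [Set.disjoint_left]; rintro t (rfl | rfl) (h | h) <;> (try simp only [Set.mem_singleton_iff] at h) <;> omega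
  -- The window starts at `i + 1` because `f i` is now represented by the position `i + m`.
  · refine hI (i + 1) _ _ ?_ ?_ ?_
    · rintro t ⟨_, _⟩; constructor <;> omega
    · rintro t ⟨_, _⟩; constructor <;> omega
    · rw [Set.disjoint_left]; rintro t ⟨_, _⟩ ⟨_, _⟩; omega
  · refine hI (i + 1) _ _ ?_ ?_ ?_
    · rintro t ⟨_, _⟩; constructor <;> omega
    · rintro t ⟨_, _⟩; constructor <;> omega
    · rw [Set.disjoint_left]; rintro t ⟨_, _⟩ ⟨_, _⟩; omega

end SimpleGraph.IsCyclicLabelling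

/-- A 2-connected outerplanar graph has a Hamiltonian cycle (starting at any given vertex). -/
theorem IsKConnected.exists_isCyclicLabelling {V : Type*} [Fintype V] {G : SimpleGraph V}
    (hconn : IsKConnected 2 G) (hG : IsOuterplanar G) (v : V) :
    ∃ f, G.IsCyclicLabelling (Fintype.card V) f ∧ f 0 = v ∧ Function.Surjective f := by
  classical
  have hcard : 2 < Fintype.card V := by simpa [Nat.card_eq_fintype_card] using hconn.1
  have hex : ∃ m f, G.IsCyclicLabelling m f := by
    obtain ⟨a, b, c, hab, hac, hbc⟩ := Fintype.two_lt_card_iff.1 hcard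
    obtain ⟨p, -⟩ := hconn.linkedIn hac hbc
    cases p with
    | nil => exact absurd rfl hab
    | @cons _ d _ h p =>
      -- A single edge, as a degenerate cycle of length 2, starts the extension process.
      refine ⟨2, _, .of_linear (g := fun i => if i = 0 then a else d) le_rfl ?_ ?_ ?_⟩
      · intro i hi
        obtain rfl : i = 0 := by omega
        simpa using h
      · simpa using h.symm
      · intro i hi j hj hij
        have hne := h.ne
        interval_cases i <;> interval_cases j <;> simp_all
  obtain ⟨m, ⟨f, hf⟩, hmax⟩ : ∃ m, (∃ f, G.IsCyclicLabelling m f) ∧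
      ∀ m' > m, ¬ ∃ f, G.IsCyclicLabelling m' f := by
    obtain ⟨m, hm⟩ := hex
    refine ⟨_, Nat.findGreatest_spec (P := fun m => ∃ f, G.IsCyclicLabelling m f)
      hm.choose_spec.le_card hm, fun m' hm' ⟨f, hf⟩ => ?_⟩
    exact Nat.findGreatest_is_greatest hm' hf.le_card ⟨f, hf⟩
  have hsurj : Function.Surjective f := by
    by_contra hns
    obtain ⟨m', hm', h⟩ := hf.exists_longer hG hconn (by
      simpa [Function.Surjective] using hns)
    exact hmax m' hm' h
  have hle : Fintype.card V ≤ m := by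
    have : Function.Surjective fun i : Fin m => f i := by
      intro x
      obtain ⟨i, rfl⟩ := hsurj x
      obtain ⟨j, h0, h1, e⟩ := hf.exists_eq 0 i
      exact ⟨⟨j.toNat, by omega⟩, by simpa [h0] using e⟩
    simpa using Fintype.card_le_of_surjective _ this
  obtain rfl : m = Fintype.card V := le_antisymm hf.le_card hle
  obtain ⟨c, rfl⟩ := hsurj v
  refine ⟨_, hf.rotate c, by simp, fun x => ?_⟩
  obtain ⟨i, rfl⟩ := hsurj x
  exact ⟨i - c, by simp⟩

/-! ### Counting edges and weights in a noncrossing cycle. -/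

open scoped Classical in
/-- The number of `R`-neighbours of `w` in the interval `[a, b]`. -/
noncomputable def intervalDegree (R : ℤ → ℤ → Prop) (w a b : ℤ) : ℕ :=
  ((Finset.Icc a b).filter (R w)).card

open scoped Classical in
/-- The edges of `R` in the interval `[a, b]`, as pairs whose first entry has not the parity
of `c`. -/
noncomputable def intervalEdges (R : ℤ → ℤ → Prop) (c a b : ℤ) : Finset (ℤ × ℤ) :=
  (Finset.Icc a b ×ˢ Finset.Icc a b).filter fun p => Odd (p.1 - c) ∧ R p.1 p.2

/-- `R` is a periodic picture of a cycle of length `n` with pairwise noncrossing chords, each of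
which joins positions of different parity. -/
structure IsNoncrossingCycle (n : ℤ) (R : ℤ → ℤ → Prop) : Prop where
  symm : ∀ i j, R i j → R j i
  odd : ∀ i j, R i j → Odd (j - i)
  adj : ∀ i, R i (i + 1)
  cross : ∀ i j k l, i < j → j < k → k < l → l < i + n → R i k → R j l → False

namespace IsNoncrossingCycle

variable {n : ℤ} {R : ℤ → ℤ → Prop}

theorem reflect (h : IsNoncrossingCycle n R) : IsNoncrossingCycle n fun i j => R (-i) (-j) where
  symm i j := h.symm _ _
  odd i j hij := by
    have := h.odd _ _ (h.symm _ _ hij)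
    rwa [neg_sub_neg] at this
  adj i := by
    have := h.symm _ _ (h.adj (-(i + 1)))
    rwa [neg_add, neg_add_cancel_right, ← neg_add] at this
  cross i j k l hij hjk hkl hl hik hjl :=
    h.cross (-l) (-k) (-j) (-i) (by omega) (by omega) (by omega) (by omega) (h.symm _ _ hjl)
      (h.symm _ _ hik)

theorem two_dvd (h : IsNoncrossingCycle n R) {i j : ℤ} (hij : R i j) : ¬ (2 : ℤ) ∣ j - i := by
  obtain ⟨k, hk⟩ := h.odd i j hij
  omega

-- The interval is cut at the last neighbour `k` of `i` before `j`: by noncrossing, only the pair `i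
-- j` itself can straddle `k`.
open scoped Classical in
theorem two_mul_card_intervalEdges (h : IsNoncrossingCycle n R) (c : ℤ) (m : ℕ) :
    ∀ i j : ℤ, i < j → j < i + n → j - i ≤ m →
      2 * ((intervalEdges R c i j).card : ℤ) + 1 ≤ 3 * (j - i) ∧
      (¬ R i j → 2 * ((intervalEdges R c i j).card : ℤ) + 2 ≤ 3 * (j - i)) := by
  induction m with
  | zero => intro i j h1 h2 h3; omega
  | succ m ih =>
    intro i j hij hjn hm
    set e : ℤ × ℤ := if Odd (i - c) then (i, j) else (j, i) with he
    set T : Finset (ℤ × ℤ) := if R i j then {e} else ∅ with hT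
    have hTe : R i j → e ∈ T := fun hR => by simp [hT, hR]
    have hTc : (R i j → T.card = 1) ∧ (¬ R i j → T.card = 0) :=
      ⟨fun hR => by simp [hT, hR], fun hR => by simp [hT, hR]⟩
    have hend : ∀ a b, Odd (a - c) → R a b → (a = i ∧ b = j ∨ a = j ∧ b = i) → (a, b) ∈ T := by
      rintro a b ha hR (⟨rfl, rfl⟩ | ⟨rfl, rfl⟩)
      · have := hTe hR
        rwa [he, if_pos ha] at this
      · have := hTe (h.symm _ _ hR)
        rwa [he, if_neg] at this
        intro hb
        have := h.two_dvd hR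
        obtain ⟨x, hx⟩ := ha
        obtain ⟨y, hy⟩ := hb
        omega
    rcases eq_or_lt_of_le (show i + 1 ≤ j by omega) with rfl | hlt
    · have hsub : intervalEdges R c i (i + 1) ⊆ T := by
        rintro ⟨a, b⟩ hab
        simp only [intervalEdges, Finset.mem_filter, Finset.mem_product, Finset.mem_Icc] at hab
        obtain ⟨⟨⟨_, _⟩, _, _⟩, ha, hR⟩ := hab
        have := h.two_dvd hR
        exact hend a b ha hR (by omega)
      have := Finset.card_le_card hsub
      have hR := h.adj i
      rw [hTc.1 hR] at this
      exact ⟨by omega, fun h => absurd hR h⟩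
    · have hne : ((Finset.Ioo i j).filter (R i)).Nonempty :=
        ⟨i + 1, by simp [hlt, h.adj i]⟩
      obtain ⟨k, hk, hmax⟩ := Finset.exists_max_image _ id hne
      simp only [Finset.mem_filter, Finset.mem_Ioo, id] at hk hmax
      obtain ⟨⟨hik, hkj⟩, hRk⟩ := hk
      have hsplit : ∀ a b, i ≤ a → a < b → b ≤ j → R a b → b ≤ k ∨ k ≤ a ∨ (a = i ∧ b = j) := by
        intro a b ha hab hb hR
        by_contra! hcon
        obtain ⟨h1, h2, h3⟩ := hcon
        rcases eq_or_lt_of_le ha with rfl | ha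
        · have := hmax b ⟨⟨by omega, lt_of_le_of_ne hb (h3 rfl)⟩, hR⟩
          omega
        · exact h.cross i a k b ha h2 h1 (by omega) hRk hR
      have hsub : intervalEdges R c i j ⊆ T ∪ (intervalEdges R c i k ∪ intervalEdges R c k j) := by
        rintro ⟨a, b⟩ hab
        simp only [intervalEdges, Finset.mem_filter, Finset.mem_product, Finset.mem_Icc] at hab
        obtain ⟨⟨⟨ha1, ha2⟩, hb1, hb2⟩, ha, hR⟩ := hab
        simp only [Finset.mem_union, intervalEdges, Finset.mem_filter, Finset.mem_product,
          Finset.mem_Icc]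
        have h2 := h.two_dvd hR
        rcases lt_or_gt_of_ne (show a ≠ b by omega) with hlt | hlt
        · rcases hsplit a b ha1 hlt hb2 hR with h | h | h
          · exact Or.inr (Or.inl ⟨⟨⟨by omega, by omega⟩, by omega, by omega⟩, ha, hR⟩)
          · exact Or.inr (Or.inr ⟨⟨⟨by omega, by omega⟩, by omega, by omega⟩, ha, hR⟩)
          · exact Or.inl (hend a b ha hR (Or.inl h))
        · rcases hsplit b a hb1 hlt ha2 (h.symm _ _ hR) with h | h | h
          · exact Or.inr (Or.inl ⟨⟨⟨by omega, by omega⟩, by omega, by omega⟩, ha, hR⟩)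
          · exact Or.inr (Or.inr ⟨⟨⟨by omega, by omega⟩, by omega, by omega⟩, ha, hR⟩)
          · exact Or.inl (hend a b ha hR (Or.inr h.symm))
      have hcard := (Finset.card_le_card hsub).trans ((Finset.card_union_le _ _).trans
        (Nat.add_le_add_left (Finset.card_union_le _ _) _))
      have i1 := (ih i k hik (by omega) (by omega)).1
      have i2 := ih k j hkj (by omega) (by omega)
      constructor
      · by_cases hR : R i j
        · have h1 := hTc.1 hR
          -- Parity excludes the triangle `i k j`, and the sharper bound for the nonadjacent pair
          -- `k, j` pays for the edge `i j`.
          have hk : ¬ R k j := fun hkj => by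
            have := h.two_dvd hR
            have := h.two_dvd hRk
            have := h.two_dvd hkj
            omega
          have := i2.2 hk
          omega
        · have := hTc.2 hR
          omega
      · intro hR
        have := hTc.2 hR
        omega

-- The vertices of `X` have the same parity, so no edge joins two of them and the degree sum counts
-- each edge at most once.
open scoped Classical in
theorem sum_intervalDegree_le (c a b : ℤ) {X : Finset ℤ} (hX : ∀ x ∈ X, x ∈ Finset.Icc a b)
    (hodd : ∀ x ∈ X, Odd (x - c)) :
    ∑ x ∈ X, intervalDegree R x a b ≤ (intervalEdges R c a b).card := by
  simp only [intervalDegree]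
  rw [← Finset.card_sigma]
  refine Finset.card_le_card_of_injOn (fun p => (p.1, p.2)) ?_ ?_
  · rintro ⟨x, y⟩ hxy
    simp only [Finset.coe_sigma, Set.mem_sigma_iff, Finset.mem_coe, Finset.mem_filter] at hxy
    simp only [intervalEdges, Finset.coe_filter, Finset.mem_product, Set.mem_ofPred]
    exact ⟨⟨hX _ hxy.1, hxy.2.1⟩, hodd _ hxy.1, hxy.2.2⟩
  · rintro ⟨x, y⟩ - ⟨x', y'⟩ - e
    simp only [Prod.mk.injEq] at e
    obtain ⟨rfl, rfl⟩ := e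
    rfl

/-- At most every second integer of `[a, b]` has a given parity. -/
theorem two_mul_card_le_of_parity {Y : Finset ℤ} (a b c : ℤ) (hab : a ≤ b + 1)
    (hY : ∀ y ∈ Y, a ≤ y ∧ y ≤ b ∧ Odd (y - c)) : 2 * (Y.card : ℤ) ≤ b - a + 2 := by
  have : Y.card ≤ (Finset.Icc 0 ((b - a) / 2)).card := by
    refine Finset.card_le_card_of_injOn (fun y => (y - a) / 2) ?_ ?_
    · intro y hy
      obtain ⟨h1, h2, h3⟩ := hY y hy
      simp only [Finset.coe_Icc, Set.mem_Icc]
      omega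
    · intro y hy y' hy' e
      obtain ⟨h1, h2, x, h3⟩ := hY y hy
      obtain ⟨h1', h2', x', h3'⟩ := hY y' hy'
      simp only at e
      omega
  rw [Int.card_Icc] at this
  omega

open scoped Classical in
/-- The weight of the part of the picture that is cut off by a chord `l w`. -/
theorem two_mul_chord_weight (h : IsNoncrossingCycle n R) {l w : ℤ} (hlw : l < w) (hwn : w < l + n)
    (hR : R l w) :
    2 * ((∑ x ∈ (Finset.Ioo l w).filter (R l), intervalDegree R x l w +
      2 * ((Finset.Ioo l w).filter (R w)).card : ℕ) : ℤ) + 1 ≤ 3 * (w - l) := by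
  have hpar := h.two_dvd hR
  rcases eq_or_lt_of_le (show l + 1 ≤ w by omega) with rfl | hlt
  · have : Finset.Ioo l (l + 1) = ∅ := by ext x; simp
    simp [this]
  have hne : ((Finset.Ioo l w).filter (R w)).Nonempty := by
    have h1 := h.symm _ _ (h.adj (w - 1))
    rw [sub_add_cancel] at h1
    exact ⟨w - 1, by simp [h1]; omega⟩
  -- The first neighbour `y` of `w` separates the two terms: the neighbours of `l` and all their
  -- edges lie in `[l, y]`, the neighbours of `w` in `[y, w - 1]`.
  obtain ⟨y, hy, hmin⟩ := Finset.exists_min_image _ id hne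
  simp only [Finset.mem_filter, Finset.mem_Ioo, id] at hy hmin
  obtain ⟨⟨hly, hyw⟩, hRy⟩ := hy
  have hpy := h.two_dvd hRy
  have hX : ∀ x ∈ (Finset.Ioo l w).filter (R l), l < x ∧ x < y ∧ Odd (x - l) ∧
      intervalDegree R x l w = intervalDegree R x l y := by
    intro x hx
    simp only [Finset.mem_filter, Finset.mem_Ioo] at hx
    obtain ⟨⟨hlx, hxw⟩, hRx⟩ := hx
    have hpx := h.two_dvd hRx
    have hxy : x < y := by
      by_contra hxy
      exact h.cross l y x w hly (by omega) hxw hwn hRx (h.symm _ _ hRy)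
    refine ⟨hlx, hxy, h.odd _ _ hRx, ?_⟩
    unfold intervalDegree
    congr 1
    ext z
    simp only [Finset.mem_filter, Finset.mem_Icc]
    refine ⟨fun ⟨⟨h1, h2⟩, h3⟩ => ⟨⟨h1, ?_⟩, h3⟩, fun ⟨⟨h1, h2⟩, h3⟩ => ⟨⟨h1, by omega⟩, h3⟩⟩
    by_contra hzy
    have hpz := h.two_dvd h3
    exact h.cross x y z w hxy (by omega) (by omega) (by omega) h3 (h.symm _ _ hRy)
  have h1 : ∑ x ∈ (Finset.Ioo l w).filter (R l), intervalDegree R x l w ≤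
      (intervalEdges R l l y).card := by
    rw [Finset.sum_congr rfl fun x hx => (hX x hx).2.2.2]
    exact sum_intervalDegree_le l l y
      (fun x hx => Finset.mem_Icc.2 ⟨(hX x hx).1.le, (hX x hx).2.1.le⟩) fun x hx => (hX x hx).2.2.1
  have h2 := (h.two_mul_card_intervalEdges l (y - l).toNat l y hly (by omega) (by omega)).2
    (fun hly => by have := h.two_dvd hly; omega)
  have h3 := two_mul_card_le_of_parity (Y := (Finset.Ioo l w).filter (R w)) y (w - 1) w (by omega)
    (by
      intro x hx
      have := hmin x (by simpa using hx)
      simp only [Finset.mem_filter, Finset.mem_Ioo] at hx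
      exact ⟨this, by omega, h.odd _ _ hx.2⟩)
  omega

theorem intervalDegree_neg (x a b : ℤ) :
    intervalDegree (fun i j => R (-i) (-j)) (-x) (-b) (-a) = intervalDegree R x a b := by
  classical
  refine Finset.card_nbij' (fun y => -y) (fun y => -y) ?_ ?_ (fun y _ => neg_neg y)
    (fun y _ => neg_neg y)
  · intro y hy
    simp only [Finset.coe_filter, Finset.mem_Icc, Set.mem_ofPred, neg_neg] at hy ⊢
    exact ⟨by omega, hy.2⟩
  · intro y hy
    simp only [Finset.coe_filter, Finset.mem_Icc, Set.mem_ofPred, neg_neg] at hy ⊢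
    exact ⟨by omega, hy.2⟩

open scoped Classical in
theorem two_mul_chord_weight' (h : IsNoncrossingCycle n R) {w r : ℤ} (hwr : w < r) (hrn : r < w + n)
    (hR : R r w) :
    2 * ((∑ x ∈ (Finset.Ioo w r).filter (R r), intervalDegree R x w r +
      2 * ((Finset.Ioo w r).filter (R w)).card : ℕ) : ℤ) + 1 ≤ 3 * (r - w) := by
  have key := h.reflect.two_mul_chord_weight (l := -r) (w := -w) (by omega) (by omega)
    (by simpa using hR)
  have e : ∀ v, ((Finset.Ioo (-r) (-w)).filter fun j => R (- -v) (-j)) =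
      ((Finset.Ioo w r).filter (R v)).image fun y => -y := by
    intro v
    ext y
    simp only [Finset.mem_filter, Finset.mem_Ioo, Finset.mem_image, neg_neg]
    constructor
    · rintro ⟨⟨h1, h2⟩, h3⟩
      exact ⟨-y, ⟨by omega, h3⟩, neg_neg y⟩
    · rintro ⟨z, ⟨h1, h2⟩, rfl⟩
      exact ⟨by omega, by rwa [neg_neg]⟩
  rw [e, e, Finset.card_image_of_injective _ neg_injective,
    Finset.sum_image neg_injective.injOn] at key
  simp only [intervalDegree_neg] at key
  omega

open scoped Classical in
/-- The weight of the part of the picture between consecutive neighbours `l` and `r` of a vertex. -/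
theorem two_mul_gap_weight (h : IsNoncrossingCycle n R) {l r : ℤ} (hlr : l < r) (hrn : r < l + n)
    (hpar : (2 : ℤ) ∣ r - l) :
    2 * ((∑ x ∈ (Finset.Ioo l r).filter (R l), intervalDegree R x l r +
      ∑ x ∈ (Finset.Ioo l r).filter (R r), intervalDegree R x l r : ℕ) : ℤ) ≤ 3 * (r - l) + 6 := by
  -- The degree of a common neighbour `w` enters both sums, hence the factor 2 in the chord weights;
  -- its edges to `l` and `r`, counted twice, add 4. Without such a `w` the two neighbour sets are
  -- disjoint and of one parity, and the edge count suffices.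
  by_cases hw : ∃ w, l < w ∧ w < r ∧ R l w ∧ R r w
  · obtain ⟨w, hlw, hwr, hRl, hRr⟩ := hw
    have h1 := h.two_mul_chord_weight hlw (by omega) hRl
    have h2 := h.two_mul_chord_weight' hwr (by omega) hRr
    have hl : (Finset.Ioo l r).filter (R l) ⊆ insert w ((Finset.Ioo l w).filter (R l)) := by
      intro x hx
      simp only [Finset.mem_filter, Finset.mem_Ioo, Finset.mem_insert] at hx ⊢
      by_contra! hcon
      have : ¬ x < w := fun hxw => hcon.2 ⟨hx.1.1, hxw⟩ hx.2
      exact h.cross l w x r hlw (by omega) hx.1.2 hrn hx.2 (h.symm _ _ hRr)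
    have hr : (Finset.Ioo l r).filter (R r) ⊆ insert w ((Finset.Ioo w r).filter (R r)) := by
      intro x hx
      simp only [Finset.mem_filter, Finset.mem_Ioo, Finset.mem_insert] at hx ⊢
      by_contra! hcon
      have : ¬ w < x := fun hxw => hcon.2 ⟨hxw, hx.1.2⟩ hx.2
      exact h.cross l x w r hx.1.1 (by omega) hwr hrn hRl (h.symm _ _ hx.2)
    have dl : ∀ x ∈ (Finset.Ioo l w).filter (R l),
        intervalDegree R x l r ≤ intervalDegree R x l w := by
      intro x hx
      simp only [Finset.mem_filter, Finset.mem_Ioo] at hx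
      refine Finset.card_le_card fun z hz => ?_
      simp only [Finset.mem_filter, Finset.mem_Icc] at hz ⊢
      refine ⟨⟨hz.1.1, ?_⟩, hz.2⟩
      by_contra hzw
      exact h.cross l x w z hx.1.1 hx.1.2 (by omega) (by omega) hRl hz.2
    have dr : ∀ x ∈ (Finset.Ioo w r).filter (R r),
        intervalDegree R x l r ≤ intervalDegree R x w r := by
      intro x hx
      simp only [Finset.mem_filter, Finset.mem_Ioo] at hx
      refine Finset.card_le_card fun z hz => ?_
      simp only [Finset.mem_filter, Finset.mem_Icc] at hz ⊢
      refine ⟨⟨?_, hz.1.2⟩, hz.2⟩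
      by_contra hzw
      exact h.cross z w x r (by omega) hx.1.1 hx.1.2 (by omega) (h.symm _ _ hz.2) (h.symm _ _ hRr)
    have dw : intervalDegree R w l r ≤
        2 + ((Finset.Ioo l w).filter (R w)).card + ((Finset.Ioo w r).filter (R w)).card := by
      have hsub : (Finset.Icc l r).filter (R w) ⊆
          {l, r} ∪ (Finset.Ioo l w).filter (R w) ∪ (Finset.Ioo w r).filter (R w) := by
        intro z hz
        simp only [Finset.mem_filter, Finset.mem_Icc, Finset.mem_union, Finset.mem_insert,
          Finset.mem_singleton, Finset.mem_Ioo] at hz ⊢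
        have hne := h.two_dvd hz.2
        have hzw : z ≠ w := by rintro rfl; simp at hne
        have hz2 := hz.2
        simp only [hz2, and_true]
        omega
      refine (Finset.card_le_card hsub).trans ((Finset.card_union_le _ _).trans
        (Nat.add_le_add_right ((Finset.card_union_le _ _).trans
        (Nat.add_le_add_right Finset.card_le_two _)) _))
    have sl := (Finset.sum_le_sum_of_subset (f := fun x => intervalDegree R x l r) hl)
    have sr := (Finset.sum_le_sum_of_subset (f := fun x => intervalDegree R x l r) hr)
    rw [Finset.sum_insert (by simp)] at sl sr
    have tl := Finset.sum_le_sum dl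
    have tr := Finset.sum_le_sum dr
    omega
  · have hdisj : Disjoint ((Finset.Ioo l r).filter (R l)) ((Finset.Ioo l r).filter (R r)) := by
      rw [Finset.disjoint_left]
      intro w h1 h2
      simp only [Finset.mem_filter, Finset.mem_Ioo] at h1 h2
      exact hw ⟨w, h1.1.1, h1.1.2, h1.2, h2.2⟩
    rw [← Finset.sum_union hdisj]
    have h1 := sum_intervalDegree_le (R := R) l l r
      (X := (Finset.Ioo l r).filter (R l) ∪ (Finset.Ioo l r).filter (R r))
      (by
        intro x hx
        simp only [Finset.mem_union, Finset.mem_filter, Finset.mem_Ioo] at hx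
        rw [Finset.mem_Icc]
        omega)
      (by
        intro x hx
        simp only [Finset.mem_union, Finset.mem_filter, Finset.mem_Ioo] at hx
        rcases hx with hx | hx
        · exact h.odd _ _ hx.2
        · have := h.two_dvd hx.2
          rw [Int.odd_iff]
          omega)
    have h2 := (h.two_mul_card_intervalEdges l (r - l).toNat l r hlr hrn (by omega)).1
    omega

-- Induction along the neighbours `r` of `0`. The last neighbour `r` contributes only its neighbours
-- below `r`, so that passing from `l` to `r` adds exactly one gap; at `r = 1` the first estimate is
-- an equality. The second estimate, at `r = n - 1`, says that the degree is at most `n / 2`.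
open scoped Classical in
theorem two_mul_weight_le (h : IsNoncrossingCycle n R) (m : ℕ) :
    ∀ r : ℤ, 0 < r → r < n → R 0 r → r ≤ m →
      2 * ((∑ u ∈ (Finset.Ioo 0 r).filter (R 0), ∑ w ∈ (Finset.Ioo 0 n).filter (R u),
          intervalDegree R w 0 (n - 1) +
        ∑ w ∈ (Finset.Ioo 0 r).filter (R r), intervalDegree R w 0 (n - 1) : ℕ) : ℤ) + 9 ≤
        3 * r + 6 * (((Finset.Ioc 0 r).filter (R 0)).card : ℤ) ∧
      2 * (((Finset.Ioc 0 r).filter (R 0)).card : ℤ) ≤ r + 1 := by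
  induction m with
  | zero => intro r h1 h2 h3 h4; omega
  | succ m ih =>
    intro r hr0 hrn hR hm
    rcases eq_or_lt_of_le (show 1 ≤ r by omega) with rfl | hlt
    · have e1 : Finset.Ioo (0 : ℤ) 1 = ∅ := rfl
      have e2 : (Finset.Ioc (0 : ℤ) 1).filter (R 0) = {1} := by
        rw [show Finset.Ioc (0 : ℤ) 1 = {1} from rfl, Finset.filter_singleton, if_pos hR]
      rw [e1, e2]
      simp
    have hne : ((Finset.Ioo 0 r).filter (R 0)).Nonempty :=
      ⟨1, by simpa [hlt] using h.adj 0⟩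
    obtain ⟨l, hl, hmax⟩ := Finset.exists_max_image _ id hne
    simp only [Finset.mem_filter, Finset.mem_Ioo, id] at hl hmax
    obtain ⟨⟨hl0, hlr⟩, hRl⟩ := hl
    obtain ⟨ih1, ih2⟩ := ih l hl0 (by omega) hRl (by omega)
    have pr := h.two_dvd hR
    have pl := h.two_dvd hRl
    have hgap := h.two_mul_gap_weight hlr (by omega) (by omega)
    have e1 : (Finset.Ioo 0 r).filter (R 0) = insert l ((Finset.Ioo 0 l).filter (R 0)) := by
      ext x
      simp only [Finset.mem_filter, Finset.mem_Ioo, Finset.mem_insert]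
      constructor
      · intro hx
        have := hmax x hx
        by_cases hxl : x = l
        · exact Or.inl hxl
        · exact Or.inr ⟨⟨hx.1.1, by omega⟩, hx.2⟩
      · rintro (rfl | hx)
        · exact ⟨⟨hl0, hlr⟩, hRl⟩
        · exact ⟨⟨hx.1.1, by omega⟩, hx.2⟩
    have e2 : (Finset.Ioc 0 r).filter (R 0) = insert r ((Finset.Ioc 0 l).filter (R 0)) := by
      ext x
      simp only [Finset.mem_filter, Finset.mem_Ioc, Finset.mem_insert]
      constructor
      · intro hx
        by_cases hxr : x = r
        · exact Or.inl hxr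
        · have := hmax x ⟨⟨hx.1.1, by omega⟩, hx.2⟩
          exact Or.inr ⟨⟨hx.1.1, by omega⟩, hx.2⟩
      · rintro (rfl | hx)
        · exact ⟨⟨hr0, le_rfl⟩, hR⟩
        · exact ⟨⟨hx.1.1, by omega⟩, hx.2⟩
    have e3 : (Finset.Ioo 0 n).filter (R l) =
        (Finset.Ioo 0 l).filter (R l) ∪ (Finset.Ioo l r).filter (R l) := by
      ext x
      simp only [Finset.mem_filter, Finset.mem_Ioo, Finset.mem_union]
      constructor
      · intro hx
        have px := h.two_dvd hx.2
        have : ¬ r < x := fun hrx => h.cross 0 l r x hl0 hlr hrx (by omega) hR hx.2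
        have hx2 := hx.2
        simp only [hx2, and_true]
        omega
      · rintro (hx | hx)
        · exact ⟨⟨hx.1.1, by omega⟩, hx.2⟩
        · exact ⟨⟨by omega, by omega⟩, hx.2⟩
    have e4 : (Finset.Ioo 0 r).filter (R r) = (Finset.Ioo l r).filter (R r) := by
      ext x
      simp only [Finset.mem_filter, Finset.mem_Ioo]
      constructor
      · intro hx
        have px := h.two_dvd hx.2
        have : ¬ x < l := fun hxl =>
          h.cross 0 x l r hx.1.1 hxl hlr (by omega) hRl (h.symm _ _ hx.2)
        exact ⟨⟨by omega, hx.1.2⟩, hx.2⟩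
      · intro hx
        exact ⟨⟨by omega, hx.1.2⟩, hx.2⟩
    -- No `w` inside the gap is adjacent to `0`, and the chords `0 l` and `0 r` confine its other
    -- neighbours to `[l, r]`.
    have hd : ∀ w, l < w → w < r → intervalDegree R w 0 (n - 1) ≤ intervalDegree R w l r := by
      intro w hlw hwr
      refine Finset.card_le_card fun x hx => ?_
      simp only [Finset.mem_filter, Finset.mem_Icc] at hx ⊢
      have hx0 : x ≠ 0 := by
        rintro rfl
        have := hmax w ⟨⟨by omega, hwr⟩, h.symm _ _ hx.2⟩
        omega
      refine ⟨⟨?_, ?_⟩, hx.2⟩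
      · by_contra hxl
        exact h.cross 0 x l w (by omega) (by omega) hlw (by omega) hRl (h.symm _ _ hx.2)
      · by_contra hxr
        exact h.cross 0 w r x (by omega) hwr (by omega) (by omega) hR hx.2
    have hdl : ∑ w ∈ (Finset.Ioo l r).filter (R l), intervalDegree R w 0 (n - 1) ≤
        ∑ w ∈ (Finset.Ioo l r).filter (R l), intervalDegree R w l r :=
      Finset.sum_le_sum fun w hw => by
        simp only [Finset.mem_filter, Finset.mem_Ioo] at hw
        exact hd w hw.1.1 hw.1.2
    have hdr : ∑ w ∈ (Finset.Ioo l r).filter (R r), intervalDegree R w 0 (n - 1) ≤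
        ∑ w ∈ (Finset.Ioo l r).filter (R r), intervalDegree R w l r :=
      Finset.sum_le_sum fun w hw => by
        simp only [Finset.mem_filter, Finset.mem_Ioo] at hw
        exact hd w hw.1.1 hw.1.2
    have hdisj : Disjoint ((Finset.Ioo 0 l).filter (R l)) ((Finset.Ioo l r).filter (R l)) := by
      rw [Finset.disjoint_left]
      intro w h1 h2
      simp only [Finset.mem_filter, Finset.mem_Ioo] at h1 h2
      omega
    rw [e1, e2, e4, Finset.sum_insert (by simp), Finset.card_insert_of_notMem (by simp [hlr]),
      e3, Finset.sum_union hdisj]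
    constructor <;> omega

end IsNoncrossingCycle

/-! ### Transfer of the counts to the graph. -/

namespace SimpleGraph.IsCyclicLabelling

variable {V : Type*} {G : SimpleGraph V} {m : ℕ} {f : ℤ → V}

theorem isNoncrossingCycle [Finite V] (hf : G.IsCyclicLabelling m f) (hO : IsOuterplanar G)
    (hB : G.IsBipartite) : IsNoncrossingCycle m fun i j => G.Adj (f i) (f j) where
  symm _ _ h := h.symm
  odd _ _ h := hf.odd_sub hB h
  adj := hf.adj
  cross _ _ _ _ hij hjk hkl hl hik hjl := hf.not_crossing hO hB hij hjk hkl hl hik hjl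

open scoped Classical in
theorem sum_neighborFinset [Fintype V] [DecidableRel G.Adj] {M : Type*} [AddCommMonoid M]
    (hf : G.IsCyclicLabelling m f) (hs : Function.Surjective f) {R : ℤ → ℤ → Prop}
    (hR : ∀ i j, R i j ↔ G.Adj (f i) (f j)) (i : ℤ) (g : V → M) :
    ∑ x ∈ G.neighborFinset (f i), g x =
      ∑ j ∈ (Finset.Icc 0 ((m : ℤ) - 1)).filter (R i), g (f j) := by
  symm
  refine Finset.sum_nbij f ?_ ?_ ?_ fun _ _ => rfl
  · intro j hj
    simpa [hR] using (Finset.mem_filter.1 hj).2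
  · intro j hj k hk e
    simp only [Finset.coe_filter, Finset.mem_Icc, Set.mem_ofPred] at hj hk
    by_contra hne
    rcases lt_or_gt_of_ne hne with h | h
    · exact hf.ne h (by omega) e
    · exact hf.ne h (by omega) e.symm
  · intro x hx
    obtain ⟨k, rfl⟩ := hs x
    obtain ⟨j, h0, h1, e⟩ := hf.exists_eq 0 k
    refine ⟨j, ?_, e⟩
    simp only [Finset.coe_filter, Finset.mem_Icc, Set.mem_ofPred, hR, e]
    exact ⟨by omega, by simpa using hx⟩

theorem degree_eq [Fintype V] [DecidableRel G.Adj] (hf : G.IsCyclicLabelling m f)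
    (hs : Function.Surjective f) {R : ℤ → ℤ → Prop} (hR : ∀ i j, R i j ↔ G.Adj (f i) (f j)) (i : ℤ) :
    G.degree (f i) = intervalDegree R i 0 (m - 1) := by
  have := hf.sum_neighborFinset hs hR i fun _ => 1
  simpa [intervalDegree] using this

end SimpleGraph.IsCyclicLabelling

theorem IsKConnected.sum_degree_le {V : Type*} [Fintype V] {G : SimpleGraph V} [DecidableRel G.Adj]
    (hconn : IsKConnected 2 G) (hO : IsOuterplanar G) (hB : G.IsBipartite) (v : V) :
    2 * (∑ u ∈ G.neighborFinset v, ∑ w ∈ G.neighborFinset u, G.degree w) + 12 ≤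
      2 * G.degree v ^ 2 + 6 * G.degree v + 3 * Fintype.card V ∧
    2 * G.degree v ≤ Fintype.card V ∧ 2 ≤ G.degree v := by
  classical
  have hcard : 2 < Fintype.card V := by simpa [Nat.card_eq_fintype_card] using hconn.1
  obtain ⟨f, hf, rfl, hs⟩ := hconn.exists_isCyclicLabelling hO v
  set m := Fintype.card V with hm
  obtain ⟨R, hR, h⟩ : ∃ R, (∀ i j, R i j ↔ G.Adj (f i) (f j)) ∧ IsNoncrossingCycle m R :=
    ⟨_, fun _ _ => Iff.rfl, hf.isNoncrossingCycle hO hB⟩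
  have hlast : R 0 (m - 1) := by
    have := (hf.adj (-1)).symm
    rw [← hf.period (-1)] at this
    simpa [hR, neg_add_eq_sub] using this
  have hirr : ∀ i, ¬ R i i := fun i hi => ((hR i i).1 hi).ne rfl
  obtain ⟨h1, h2⟩ := h.two_mul_weight_le m (m - 1) (by omega) (by omega) hlast (by omega)
  have e0 : (Finset.Icc 0 ((m : ℤ) - 1)).filter (R 0) = (Finset.Ioc 0 ((m : ℤ) - 1)).filter (R 0) := by
    ext x
    simp only [Finset.mem_filter, Finset.mem_Icc, Finset.mem_Ioc]
    refine ⟨fun hx => ⟨⟨lt_of_le_of_ne hx.1.1 ?_, hx.1.2⟩, hx.2⟩, fun hx => ⟨⟨hx.1.1.le, hx.1.2⟩, hx.2⟩⟩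
    rintro rfl
    exact hirr 0 hx.2
  have e1 : (Finset.Ioc 0 ((m : ℤ) - 1)).filter (R 0) =
      insert ((m : ℤ) - 1) ((Finset.Ioo 0 ((m : ℤ) - 1)).filter (R 0)) := by
    ext x
    simp only [Finset.mem_filter, Finset.mem_Ioo, Finset.mem_Ioc, Finset.mem_insert]
    constructor
    · intro hx
      by_cases hxm : x = m - 1
      · exact Or.inl hxm
      · exact Or.inr ⟨⟨hx.1.1, by omega⟩, hx.2⟩
    · rintro (rfl | hx)
      · exact ⟨⟨by omega, le_rfl⟩, hlast⟩
      · exact ⟨⟨hx.1.1, by omega⟩, hx.2⟩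
  have e2 : (Finset.Ioo 0 (m : ℤ)).filter (R (m - 1)) =
      (Finset.Ioo 0 ((m : ℤ) - 1)).filter (R (m - 1)) := by
    ext x
    simp only [Finset.mem_filter, Finset.mem_Ioo]
    refine ⟨fun hx => ⟨⟨hx.1.1, lt_of_le_of_ne (by omega) ?_⟩, hx.2⟩, fun hx => ⟨⟨hx.1.1, by omega⟩, hx.2⟩⟩
    rintro rfl
    exact hirr _ hx.2
  have e3 : ∀ u, R 0 u → (Finset.Icc 0 ((m : ℤ) - 1)).filter (R u) =
      insert 0 ((Finset.Ioo 0 (m : ℤ)).filter (R u)) := by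
    intro u hu
    ext x
    simp only [Finset.mem_filter, Finset.mem_Ioo, Finset.mem_Icc, Finset.mem_insert]
    constructor
    · intro hx
      by_cases hx0 : x = 0
      · exact Or.inl hx0
      · exact Or.inr ⟨⟨by omega, by omega⟩, hx.2⟩
    · rintro (rfl | hx)
      · exact ⟨⟨le_rfl, by omega⟩, h.symm _ _ hu⟩
      · exact ⟨⟨hx.1.1.le, by omega⟩, hx.2⟩
  have hdeg : G.degree (f 0) = ((Finset.Ioc 0 ((m : ℤ) - 1)).filter (R 0)).card := by
    rw [← e0, hf.degree_eq hs hR]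
    rfl
  -- The square comes from the walks that return to `f 0` after two steps.
  have hsum : ∑ u ∈ G.neighborFinset (f 0), ∑ w ∈ G.neighborFinset u, G.degree w =
      G.degree (f 0) ^ 2 + (∑ u ∈ (Finset.Ioo 0 ((m : ℤ) - 1)).filter (R 0),
        ∑ w ∈ (Finset.Ioo 0 (m : ℤ)).filter (R u), intervalDegree R w 0 (m - 1) +
        ∑ w ∈ (Finset.Ioo 0 ((m : ℤ) - 1)).filter (R (m - 1)), intervalDegree R w 0 (m - 1)) := by
    have s1 : ∀ u, R 0 u → ∑ w ∈ G.neighborFinset (f u), G.degree w = G.degree (f 0) +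
        ∑ w ∈ (Finset.Ioo 0 (m : ℤ)).filter (R u), intervalDegree R w 0 (m - 1) := by
      intro u hu
      rw [hf.sum_neighborFinset hs hR, e3 u hu, Finset.sum_insert (by simp)]
      simp only [hf.degree_eq hs hR]
    rw [hf.sum_neighborFinset hs hR]
    have s2 : ∑ j ∈ (Finset.Icc 0 ((m : ℤ) - 1)).filter (R 0), ∑ w ∈ G.neighborFinset (f j), G.degree w
        = ∑ j ∈ (Finset.Icc 0 ((m : ℤ) - 1)).filter (R 0), (G.degree (f 0) +
        ∑ w ∈ (Finset.Ioo 0 (m : ℤ)).filter (R j), intervalDegree R w 0 (m - 1)) :=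
      Finset.sum_congr rfl fun u hu => s1 u (Finset.mem_filter.1 hu).2
    refine s2.trans ?_
    rw [Finset.sum_add_distrib, e0, Finset.sum_const, ← hdeg, e1, Finset.sum_insert (by simp), e2,
      smul_eq_mul, sq]
    ring
  have hcard2 : 2 ≤ G.degree (f 0) := by
    rw [hdeg]
    have : ({1, (m : ℤ) - 1} : Finset ℤ) ⊆ (Finset.Ioc 0 ((m : ℤ) - 1)).filter (R 0) := by
      intro x hx
      simp only [Finset.mem_insert, Finset.mem_singleton] at hx
      rw [Finset.mem_filter, Finset.mem_Ioc]
      rcases hx with rfl | rfl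
      · exact ⟨by omega, h.adj 0⟩
      · exact ⟨by omega, hlast⟩
    have h2 := Finset.card_le_card this
    rwa [Finset.card_pair (by omega)] at h2
  rw [← hdeg] at h1 h2
  rw [hsum]
  refine ⟨?_, by omega, hcard2⟩
  zify
  push_cast at h1
  linarith

/-! ### Walks of length 3 and the spectral radius. -/

theorem numWalksFrom_three {V : Type*} [Fintype V] [DecidableEq V] (G : SimpleGraph V)
    [DecidableRel G.Adj] (v : V) :
    (numWalksFrom G 3 v : ℝ) =
      ((∑ u ∈ G.neighborFinset v, ∑ w ∈ G.neighborFinset u, G.degree w : ℕ) : ℝ) := by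
  have h1 : ∀ M : Matrix V V ℝ, ∀ v, ∑ u, M v u = M.mulVec (fun _ => 1) v := fun M v => by
    simp [Matrix.mulVec, dotProduct]
  rw [numWalksFrom_eq_rowSum, h1, pow_three, ← Matrix.mulVec_mulVec, ← Matrix.mulVec_mulVec,
    SimpleGraph.adjMatrix_mulVec_apply]
  simp only [SimpleGraph.adjMatrix_mulVec_apply, Finset.sum_const, nsmul_eq_mul, mul_one,
    SimpleGraph.card_neighborFinset_eq_degree, Nat.cast_sum]

/-- If a positive vector `d` satisfies `A² d ≤ M d` for the adjacency matrix `A`, then the squares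
of the eigenvalues of `A` are at most `M`. -/
theorem norm_sq_eigenvalue_le {V : Type*} [Fintype V] {G : SimpleGraph V} [DecidableRel G.Adj]
    {d : V → ℝ} {M : ℝ} (hd : ∀ v, 0 < d v)
    (hM : ∀ v, ∑ u ∈ G.neighborFinset v, ∑ w ∈ G.neighborFinset u, d w ≤ M * d v)
    {k : ℂ} {x : V → ℂ} (hx : x ≠ 0) (hk : (G.adjMatrix ℂ).mulVec x = k • x) : ‖k‖ ^ 2 ≤ M := by
  obtain ⟨v₀, hv₀⟩ := Function.ne_iff.1 hx
  -- At a vertex maximising `‖x v‖ / d v`, the vector `x` is dominated by a multiple of `d`, with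
  -- equality at `v`.
  obtain ⟨v, -, hv⟩ := Finset.exists_max_image Finset.univ (fun v => ‖x v‖ / d v) ⟨v₀, Finset.mem_univ _⟩
  set c := ‖x v‖ / d v with hc
  have hxv : ∀ w, ‖x w‖ ≤ c * d w := fun w => (div_le_iff₀ (hd w)).1 (hv w (Finset.mem_univ w))
  have hcpos : 0 < c := lt_of_lt_of_le (div_pos (norm_pos_iff.2 hv₀) (hd v₀)) (hv v₀ (Finset.mem_univ _))
  have hk1 : ∀ v, k * x v = ∑ u ∈ G.neighborFinset v, x u := fun v => by
    have := congrFun hk v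
    rw [SimpleGraph.adjMatrix_mulVec_apply] at this
    simpa using this.symm
  have hk2 : k ^ 2 * x v = ∑ u ∈ G.neighborFinset v, ∑ w ∈ G.neighborFinset u, x w := by
    rw [sq, mul_assoc, hk1, Finset.mul_sum]
    exact Finset.sum_congr rfl fun u _ => hk1 u
  have hle : ‖k‖ ^ 2 * (c * d v) ≤ M * (c * d v) := by
    calc ‖k‖ ^ 2 * (c * d v) = ‖k ^ 2 * x v‖ := by
          rw [norm_mul, norm_pow, hc, div_mul_cancel₀ _ (hd v).ne']
      _ ≤ ∑ u ∈ G.neighborFinset v, ∑ w ∈ G.neighborFinset u, ‖x w‖ := by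
          rw [hk2]
          exact (norm_sum_le _ _).trans (Finset.sum_le_sum fun u _ => norm_sum_le _ _)
      _ ≤ ∑ u ∈ G.neighborFinset v, ∑ w ∈ G.neighborFinset u, c * d w :=
          Finset.sum_le_sum fun u _ => Finset.sum_le_sum fun w _ => hxv w
      _ = c * ∑ u ∈ G.neighborFinset v, ∑ w ∈ G.neighborFinset u, d w := by
          simp only [Finset.mul_sum]
      _ ≤ c * (M * d v) := mul_le_mul_of_nonneg_left (hM v) hcpos.le
      _ = M * (c * d v) := by ring
  exact le_of_mul_le_mul_right hle (mul_pos hcpos (hd v))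

theorem mainTheorem6 {V : Type*} [Fintype V] [DecidableEq V] (G : SimpleGraph V)
    [DecidableRel G.Adj] (hmax : IsMaximalBipartiteOuterplanar G) (hconn : IsKConnected 2 G)
    (hn : 16 ≤ Fintype.card V) :
    (∀ v : V, (numWalksFrom G 3 v : ℝ) ≤
      ((G.degree v : ℝ) + 3 + (3 * (Fintype.card V : ℝ) / 2 - 6) / (G.degree v : ℝ)) *
        (G.degree v : ℝ)) ∧
    spectralRadius ℂ (G.adjMatrix ℂ) ≤
      ENNReal.ofReal (Real.sqrt (3 * (Fintype.card V : ℝ) / 4 + 2)) := by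
  have key := hconn.sum_degree_le hmax.2.1 hmax.1
  have hd : ∀ v, (0 : ℝ) < G.degree v := fun v => by
    have := (key v).2.2
    exact_mod_cast (show 0 < G.degree v by omega)
  have hS : ∀ v, 2 * ((∑ u ∈ G.neighborFinset v, ∑ w ∈ G.neighborFinset u, G.degree w : ℕ) : ℝ) + 12 ≤
      2 * (G.degree v : ℝ) ^ 2 + 6 * G.degree v + 3 * Fintype.card V := fun v => by
    exact_mod_cast (key v).1
  constructor
  · intro v
    rw [numWalksFrom_three, add_mul, div_mul_cancel₀ _ (hd v).ne']
    nlinarith [hS v]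
  · refine iSup₂_le fun k hk => ?_
    rw [← enorm_eq_nnnorm, ← ofReal_norm k]
    apply ENNReal.ofReal_le_ofReal
    apply Real.le_sqrt_of_sq_le
    have hk' : Module.End.HasEigenvalue (Matrix.toLin' (G.adjMatrix ℂ)) k := by
      rw [Module.End.hasEigenvalue_iff_mem_spectrum, Matrix.spectrum_toLin']
      exact hk
    obtain ⟨x, hx⟩ := hk'.exists_hasEigenvector
    refine norm_sq_eigenvalue_le hd (fun v => ?_) hx.2 (by simpa using hx.apply_eq_smul)
    have h1 := hS v
    have h2 : (2 : ℝ) * G.degree v ≤ Fintype.card V := by exact_mod_cast (key v).2.1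
    have h3 : (2 : ℝ) ≤ G.degree v := by exact_mod_cast (key v).2.2
    have h4 : (16 : ℝ) ≤ Fintype.card V := by exact_mod_cast hn
    push_cast at h1
    -- With $(n-2d)(d-2)\ge 0$ the claim reduces to $(d-2)(n-12)\ge 0$.
    nlinarith [mul_nonneg (sub_nonneg.2 h2) (sub_nonneg.2 h3)]
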